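/- Let $V$ be a finite set of points on a circle in the plane and let $E\subset V\times V$ be a set of directed edges such that every $v\in V$ has exactly one incoming edge $v^-v$ and exactly one outgoing edge $vv^+$, and such that $v^-,v,v^+$ are (distinct and) in anti-clockwise order. Then $P=P(V,E)$ is called a cyclic polygon. The length of an edge $uv$ is the number of vertices on the anti-clockwise arc from $u$ to $v$, excluding $u$ and including $v$. A star is a cyclic polygon which, for some integer $k\ge 1$, has $2k+1$ vertices and all of whose edges have length $k$. A diagonal of $P$ is an undirected segment $\overline{uv}$ with $u,v\in V$ that splits both angles $\angle u^-uu^+$ and $\angle v^-vv^+$ (i.e. runs strictly inside them). For a set $D$ of diagonals, let $\tilde D$ be the set of all directed edges $uv$ and $vu$ with $\overline{uv}\in D$. Define $f_{\rm next}$ on $E\cup\tilde D$ by $f_{\rm next}(uv)=vw$, where $vw\in E\cup\tilde D$ is the edge such that $u,v,w$ are in anti-clockwise order and no diagonal in $D$ splits $\angle uvw$. The map $f_{\rm next}$ is a bijection, so $E\cup\tilde D$ is partitioned into oriented cycles. If all these cycles are stars, they form a star decomposition of $P$ with respect to $D$. It is maximal if there is no star decomposition of $P$ with respect to any proper superset $D'\supsetneq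 D$ of diagonals. A diagonal flip replaces a star decomposition of $P$ with respect to $D$ by a star decomposition of $P$ with respect to $D'=(D\setminus\{e\})\cup\{f\}$, for some $e\in D$ and some diagonal $f\notin D$. Theorem. Let $\mathcal S_1$ and $\mathcal S_2$ be maximal star decompositions of a common cyclic polygon $P$. Then $\mathcal S_1$ can be transformed into $\mathcal S_2$ by a finite (possibly empty) sequence of diagonal flips. -/

import Mathlib

/-- The points `u`, `v`, `w` of the plane `ℂ` are in anti-clockwise order, that is, the signed
area of the triangle `u v w` is positive.  For points of a common circle this says that they
are pairwise distinct and are met in the cyclic order `u`, `v`, `w` when the circle is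
traversed anti-clockwise. -/
def Anticlockwise (u v w : ℂ) : Prop :=
  0 < (v - u).re * (w - u).im - (v - u).im * (w - u).re

/-- For `u`, `v`, `w` in anti-clockwise order, the point `x` is in the interior of the angle
`∠ u v w`: it is strictly to the left of the lines `u → v` and `v → w`.  Equivalently, the
segment `v x` splits `∠ u v w` into the smaller angles `∠ u v x` and `∠ x v w`. -/
def InsideAngle (u v w x : ℂ) : Prop :=
  Anticlockwise u v x ∧ Anticlockwise v w x

/-- A cyclic polygon: a finite set `V` of points of a circle together with a set `E` of directed
edges `(u, v)`, such that every vertex has exactly one incoming and exactly one outgoing edge,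
and for any two consecutive edges `(u, v)`, `(v, w)` the points `u`, `v`, `w` are arranged in
anti-clockwise order. -/
structure CyclicPolygon where
  V : Set ℂ
  E : Set (ℂ × ℂ)
  finite_V : V.Finite
  concyclic : ∃ (c : ℂ) (r : ℝ), 0 < r ∧ ∀ v ∈ V, dist v c = r
  fst_mem : ∀ e ∈ E, e.1 ∈ V
  snd_mem : ∀ e ∈ E, e.2 ∈ V
  existsUnique_in : ∀ v ∈ V, ∃! u, (u, v) ∈ E
  existsUnique_out : ∀ v ∈ V, ∃! w, (v, w) ∈ E
  anticlockwise : ∀ u v w, (u, v) ∈ E → (v, w) ∈ E → Anticlockwise u v w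

namespace CyclicPolygon

/-- The length of the edge `(u, v)`: the number of vertices on the anti-clockwise arc from `u`
to `v`, where `u` is excluded and `v` is included. -/
noncomputable def edgeLength (P : CyclicPolygon) (e : ℂ × ℂ) : ℕ :=
  {x ∈ P.V | Anticlockwise e.1 x e.2 ∨ x = e.2}.ncard

/-- A `k`-star: a cyclic polygon with `2 k + 1` vertices all of whose edges have length `k`. -/
def IsKStar (P : CyclicPolygon) (k : ℕ) : Prop :=
  P.V.ncard = 2 * k + 1 ∧ ∀ e ∈ P.E, P.edgeLength e = k

/-- A star: a `k`-star for some positive integer `k`. -/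
def IsStar (P : CyclicPolygon) : Prop :=
  ∃ k : ℕ, 0 < k ∧ P.IsKStar k

/-- The segment from the vertex `v` to the point `x` splits the angle `∠ v⁻ v v⁺` of `P` at `v`,
where `(v⁻, v)` and `(v, v⁺)` are the edges of `P` at `v`. -/
def SplitsAngleAt (P : CyclicPolygon) (v x : ℂ) : Prop :=
  ∃ a b, (a, v) ∈ P.E ∧ (v, b) ∈ P.E ∧ InsideAngle a v b x

/-- A linkable pair of vertices: the segment `u v` splits the angles of `P` at `u` and `v`. -/
def Linkable (P : CyclicPolygon) (u v : ℂ) : Prop :=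
  u ∈ P.V ∧ v ∈ P.V ∧ P.SplitsAngleAt u v ∧ P.SplitsAngleAt v u

/-- A diagonal: the unordered pair of endpoints of a linkable pair. -/
def IsDiagonal (P : CyclicPolygon) (d : Sym2 ℂ) : Prop :=
  ∃ u v, P.Linkable u v ∧ d = s(u, v)

/-- The edge set of the polygon subdivided by `D`: the edges of `P` and both orientations of
each diagonal in `D`. -/
def subdividedEdges (P : CyclicPolygon) (D : Set (Sym2 ℂ)) : Set (ℂ × ℂ) :=
  P.E ∪ {e | s(e.1, e.2) ∈ D}

/-- The graph of the successor function on the edges of the subdivided polygon: `(u, v)` is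
followed by the edge `(v, w)` such that `u`, `v`, `w` are in anti-clockwise order and no
diagonal in `D` splits `∠ u v w`. -/
def Next (P : CyclicPolygon) (D : Set (Sym2 ℂ)) (e f : ℂ × ℂ) : Prop :=
  e ∈ P.subdividedEdges D ∧ f ∈ P.subdividedEdges D ∧ f.1 = e.2 ∧
    Anticlockwise e.1 e.2 f.2 ∧ ∀ x, s(e.2, x) ∈ D → ¬ InsideAngle e.1 e.2 f.2 x

/-- The edges of the cycle obtained by following the successor function from `e`. -/
def cycleFrom (P : CyclicPolygon) (D : Set (Sym2 ℂ)) (e : ℂ × ℂ) : Set (ℂ × ℂ) :=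
  {f | Relation.ReflTransGen (P.Next D) e f}

/-- The set `D` of diagonals of `P` gives a star decomposition of `P`: every cycle of the cycle
decomposition of `P` with respect to `D` is (the edge set of) a star. -/
def IsStarDecomposition (P : CyclicPolygon) (D : Set (Sym2 ℂ)) : Prop :=
  (∀ d ∈ D, P.IsDiagonal d) ∧
    ∀ e ∈ P.subdividedEdges D, ∃ S : CyclicPolygon, S.IsStar ∧ S.E = P.cycleFrom D e

/-- A star decomposition is maximal if no proper superset of its set of diagonals gives a star
decomposition. -/
def IsMaximalStarDecomposition (P : CyclicPolygon) (D : Set (Sym2 ℂ)) : Prop :=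
  P.IsStarDecomposition D ∧ ∀ D', D ⊂ D' → ¬ P.IsStarDecomposition D'

/-- A diagonal flip from the star decomposition with diagonals `D` to the one with diagonals
`D'`: one diagonal `e ∈ D` is replaced with a diagonal `f ∉ D`. -/
def IsFlip (P : CyclicPolygon) (D D' : Set (Sym2 ℂ)) : Prop :=
  P.IsStarDecomposition D ∧ P.IsStarDecomposition D' ∧
    ∃ e ∈ D, ∃ f, f ∉ D ∧ D' = (D \ {e}) ∪ {f}

end CyclicPolygon

/-!
The proof translates star decompositions into arrangements of pseudolines.

Number the vertices anti-clockwise by the integers, with period `n` (`Unrolling`), and let the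
integer `p + q` stand for the direction of the chord from `p` to `q`, which is its direction if the
vertices are those of a regular `n`-gon.  Rotate a line anti-clockwise inside an angle of the
subdivided polygon; whenever it arrives at an edge or at a diagonal in `D`, change the pivot to the
other end (`step`).  The line then moves along a cycle of the decomposition, from each edge to the
previous one, and this cycle is a star if and only if the line returns to itself after exactly one
half-turn.  So `D` gives a star decomposition if and only if all these lines close up after a
half-turn (`Closed`, `Unrolls.isStarDecomposition_iff`).

Parallel lines are ordered by their position, and a half-turn reverses this order.  The order of two
lines can change only where both are rotated past the same diagonal, which is not in `D`; at a
diagonal in `D` two lines touch and stay on their sides.  Hence any two of the lines ("strands")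
cross at least once (`Closed.exists_crossing`).  If two strands meet at two diagonals, then for each
of these one can exchange whether they cross or touch there: in between, the strands swap their
roles (`Closed.toggle`).  In particular, for a maximal star decomposition any two strands cross
exactly once (`Closed.tight_of_maximal`), and this property is preserved if the number of diagonals
is (`Closed.tight_iff`), since each diagonal outside `D` is the crossing of one pair of strands.

Let two star decompositions with this property be given, and cut the sweep open, so that it runs
from direction `0` to direction `n`.  Let `d` be a diagonal with the latest direction among those in
which they differ, contained in the first, say.  The two strands touching at `d` in the first
decomposition do not cross later, as from there on they agree with two strands of the second
decomposition that cross at `d`.  So they cross at a diagonal `r` with an earlier direction, and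
flipping `d` to `r` brings the first decomposition closer to the second one (`exists_exchange`,
`exchange_connected`).  This is the exchange property of reduced words in the symmetric group, read
off the strands.
-/

/-! ### Sweeping a cyclically labelled polygon -/

/-- The combinatorial data of a cyclic polygon with `n` vertices, unrolled to the integers: `pt`
enumerates the vertices anti-clockwise with period `n`, and the edge leaving (entering) the vertex
`pt i` ends at `pt (next i)` (starts at `pt (prev i)`), where the representatives are chosen with
`prev i < i < next i < prev i + n`. -/
structure Unrolling (α : Type*) where
  n : ℕ
  pt : ℤ → α
  pt_eq_iff : ∀ i j, pt i = pt j ↔ (n : ℤ) ∣ j - i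
  next : ℤ → ℤ
  prev : ℤ → ℤ
  next_prev : ∀ i, next (prev i) = i
  prev_next : ∀ i, prev (next i) = i
  next_add : ∀ i, next (i + n) = next i + n
  prev_add : ∀ i, prev (i + n) = prev i + n
  lt_next : ∀ i, i < next i
  next_lt : ∀ i, next i < prev i + n

namespace Unrolling

variable {α : Type*} (W : Unrolling α)

/-- A state `(p, q)` stands for the line through the pivot `pt p` that meets the circle again
between `pt q` and `pt (q + 1)`; it is admissible if the line splits the angle of the polygon at
`pt p`.  As an admissible line has `q ≢ p` modulo `n`, the representatives can be and are chosen
with `|q - p| < n`, which leaves two choices, `p < q` and `q < p`. -/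
def Pivot (s : ℤ × ℤ) : Prop :=
  (W.next s.1 ≤ s.2 ∧ s.2 < W.prev s.1 + W.n) ∨ (W.next s.1 ≤ s.2 + W.n ∧ s.2 < W.prev s.1)

/-- The chord joining the two points of a state. -/
def chord (s : ℤ × ℤ) : Sym2 α := s(W.pt s.1, W.pt s.2)

/-- The chords that split the angles at both of their ends. -/
def diagonals : Set (Sym2 α) := {d | ∃ s, W.Pivot s ∧ W.Pivot s.swap ∧ d = W.chord s}

open Classical in
/-- Rotate the line of a state about its pivot past the next vertex of the circle, and continue
with that vertex as the pivot if the line has arrived at an edge of the polygon or at a chord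
in `D`.  The sum of the two components, which measures the direction of the line, grows
by `1`. -/
noncomputable def step (D : Set (Sym2 α)) (s : ℤ × ℤ) : ℤ × ℤ :=
  if W.Pivot (s.1, s.2 + 1) ∧ W.chord (s.1, s.2 + 1) ∉ D then (s.1, s.2 + 1) else (s.2 + 1, s.1)

/-- The representatives of the same line after a rotation through a half-turn. -/
def flip (s : ℤ × ℤ) : ℤ × ℤ := if s.1 < s.2 then (s.1 + W.n, s.2) else (s.1, s.2 + W.n)

/-- Every line that is swept by `step` returns to itself after one half-turn. -/
def Closed (D : Set (Sym2 α)) : Prop := ∀ s, W.Pivot s → (W.step D)^[W.n] s = W.flip s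

variable {W}

lemma prev_lt (i : ℤ) : W.prev i < i := by
  have := W.lt_next (W.prev i)
  rwa [W.next_prev] at this

lemma n_pos : 0 < W.n := by
  have h1 := W.lt_next 0
  have h2 := W.next_lt 0
  have h3 := prev_lt (W := W) 0
  omega

lemma next_add_mul (i k : ℤ) : W.next (i + k * W.n) = W.next i + k * W.n := by
  induction k using Int.induction_on with
  | zero => simp
  | succ k ih =>
    rw [show i + ((k : ℤ) + 1) * W.n = i + k * W.n + W.n by ring, W.next_add, ih]; ring
  | pred k ih =>
    have := W.next_add (i + (-(k : ℤ) - 1) * W.n)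
    rw [show i + (-(k : ℤ) - 1) * W.n + W.n = i + -(k : ℤ) * W.n by ring, ih] at this
    linarith

lemma prev_add_mul (i k : ℤ) : W.prev (i + k * W.n) = W.prev i + k * W.n := by
  conv_lhs => rw [← W.next_prev i, ← next_add_mul, W.prev_next]

lemma Pivot.window {s : ℤ × ℤ} (h : W.Pivot s) :
    (s.1 < s.2 ∧ s.2 + 1 < s.1 + W.n) ∨ (s.2 + 1 < s.1 ∧ s.1 < s.2 + W.n) := by
  have h1 := W.lt_next s.1
  have h2 := prev_lt (W := W) s.1
  unfold Pivot at h
  omega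

lemma Pivot.congr {s t : ℤ × ℤ} (h : W.Pivot t) (h1 : (W.n : ℤ) ∣ s.1 - t.1)
    (h2 : (W.n : ℤ) ∣ s.2 - t.2) (h3 : -(W.n : ℤ) < s.2 - s.1) (h4 : s.2 - s.1 < W.n) :
    W.Pivot s := by
  obtain ⟨p, q⟩ := s
  obtain ⟨p', q'⟩ := t
  obtain ⟨i, hi⟩ := h1
  obtain ⟨j, hj⟩ := h2
  simp only at hi hj h3 h4
  have hp : p = p' + i * W.n := by linarith
  have hq : q = q' + j * W.n := by linarith
  have hw := h.window
  simp only at hw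
  have hn := n_pos (W := W)
  have hlt1 := W.lt_next p'
  have hlt2 := prev_lt (W := W) p'
  have hji1 : j - i < 2 := by
    by_contra hc
    have : 2 * (W.n : ℤ) ≤ (j - i) * W.n := by gcongr; omega
    have e : q - p = q' - p' + (j - i) * W.n := by rw [hp, hq]; ring
    omega
  have hji2 : -2 < j - i := by
    by_contra hc
    have : (j - i) * W.n ≤ -2 * (W.n : ℤ) := by gcongr; omega
    have e : q - p = q' - p' + (j - i) * W.n := by rw [hp, hq]; ring
    omega
  unfold Pivot at h ⊢
  simp only [hp, next_add_mul, prev_add_mul] at h ⊢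
  obtain hji | hji | hji : j = i ∨ j = i + 1 ∨ j = i - 1 := by omega
  · subst hji; omega
  · have : q = q' + i * W.n + W.n := by rw [hq, hji]; ring
    omega
  · have : q = q' + i * W.n - W.n := by rw [hq, hji]; ring
    omega

lemma chord_eq_iff {s t : ℤ × ℤ} : W.chord s = W.chord t ↔
    ((W.n : ℤ) ∣ s.1 - t.1 ∧ (W.n : ℤ) ∣ s.2 - t.2) ∨
      ((W.n : ℤ) ∣ s.2 - t.1 ∧ (W.n : ℤ) ∣ s.1 - t.2) := by
  simp only [chord, Sym2.eq_iff, W.pt_eq_iff]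
  simp only [dvd_sub_comm (a := (W.n : ℤ)) (b := t.1), dvd_sub_comm (a := (W.n : ℤ)) (b := t.2)]
  tauto

@[simp] lemma chord_swap (s : ℤ × ℤ) : W.chord s.swap = W.chord s := Sym2.eq_swap

lemma chord_mk_swap (p q : ℤ) : W.chord (p, q) = W.chord (q, p) := Sym2.eq_swap

lemma pivot_of_chord_mem {s : ℤ × ℤ} (h : W.chord s ∈ W.diagonals)
    (h3 : -(W.n : ℤ) < s.2 - s.1) (h4 : s.2 - s.1 < W.n) : W.Pivot s ∧ W.Pivot s.swap := by
  obtain ⟨t, ht, ht', e⟩ := h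
  rcases chord_eq_iff.1 e with ⟨h1, h2⟩ | ⟨h1, h2⟩
  · exact ⟨ht.congr h1 h2 h3 h4, ht'.congr h2 h1 (by simp; omega) (by simp; omega)⟩
  · exact ⟨ht'.congr h2 h1 h3 h4, ht.congr h1 h2 (by simp; omega) (by simp; omega)⟩

/-- A chord and a direction determine the unordered pair of admissible representatives. -/
lemma eq_or_eq_swap_of_chord_eq {s t : ℤ × ℤ} (hs : W.Pivot s) (ht : W.Pivot t)
    (hsum : s.1 + s.2 = t.1 + t.2) (h : W.chord s = W.chord t) : s = t ∨ s = t.swap := by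
  have aux : ∀ s t : ℤ × ℤ, (-(W.n : ℤ) < s.2 - s.1 ∧ s.2 - s.1 < W.n) →
      (-(W.n : ℤ) < t.2 - t.1 ∧ t.2 - t.1 < W.n) → s.1 + s.2 = t.1 + t.2 →
      (W.n : ℤ) ∣ s.1 - t.1 → s = t := by
    rintro ⟨p, q⟩ ⟨p', q'⟩ h1 h2 h3 ⟨i, hi⟩
    simp only at h1 h2 h3 hi
    have hn := n_pos (W := W)
    have hi0 : i = 0 := by
      by_contra hne
      rcases lt_or_gt_of_ne hne with hlt | hlt
      · have : (W.n : ℤ) * i ≤ W.n * (-1) := by gcongr; omega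
        omega
      · have : (W.n : ℤ) * 1 ≤ W.n * i := by gcongr; omega
        omega
    subst hi0
    simp only [Prod.mk.injEq]
    omega
  have ws := hs.window
  have wt := ht.window
  rcases chord_eq_iff.1 h with ⟨h1, h2⟩ | ⟨h1, h2⟩
  · exact .inl (aux s t (by omega) (by omega) hsum h1)
  · exact .inr (aux s t.swap (by omega) (by simp; omega) (by simp; omega) (by simpa using h2))

lemma step_sum (D : Set (Sym2 α)) (s : ℤ × ℤ) :
    (W.step D s).1 + (W.step D s).2 = s.1 + s.2 + 1 := by
  unfold step; split_ifs <;> simp <;> ring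

lemma iterate_step_sum (D : Set (Sym2 α)) (s : ℤ × ℤ) (k : ℕ) :
    ((W.step D)^[k] s).1 + ((W.step D)^[k] s).2 = s.1 + s.2 + k := by
  induction k with
  | zero => simp
  | succ k ih => rw [Function.iterate_succ_apply', step_sum, ih]; push_cast; ring

/-- If the line of an admissible state cannot be rotated past the next vertex, then it has arrived
at the edge entering the pivot. -/
lemma Pivot.prev_of_not {p q : ℤ} (h : W.Pivot (p, q)) (h' : ¬ W.Pivot (p, q + 1)) :
    q + 1 = W.prev p ∨ q + 1 = W.prev p + W.n := by
  unfold Pivot at h h'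
  simp only at h h'
  omega

lemma Pivot.swap_of_not {p q : ℤ} (h : W.Pivot (p, q)) (h' : ¬ W.Pivot (p, q + 1)) :
    W.Pivot (q + 1, p) := by
  have h1 := prev_lt (W := W) (W.prev p)
  have h2 := W.next_lt (W.prev p)
  rcases h.prev_of_not h' with e | e <;> rw [e] <;> unfold Pivot <;>
    simp only [W.next_add, W.prev_add, W.next_prev] at h2 ⊢ <;> omega

lemma Pivot.step {D : Set (Sym2 α)} (hD : D ⊆ W.diagonals) {s : ℤ × ℤ} (h : W.Pivot s) :
    W.Pivot (W.step D s) := by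
  obtain ⟨p, q⟩ := s
  have hw := h.window
  unfold Unrolling.step
  simp only at hw ⊢
  split_ifs with hc
  · exact hc.1
  · by_cases h1 : W.Pivot (p, q + 1)
    · have h2 : W.chord (p, q + 1) ∈ W.diagonals := hD (by tauto)
      exact (pivot_of_chord_mem h2 (by simp only; omega) (by simp only; omega)).2
    · exact h.swap_of_not h1

lemma Pivot.iterate {D : Set (Sym2 α)} (hD : D ⊆ W.diagonals) {s : ℤ × ℤ} (h : W.Pivot s) (k : ℕ) :
    W.Pivot ((W.step D)^[k] s) := by
  induction k with
  | zero => exact h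
  | succ k ih => rw [Function.iterate_succ_apply']; exact ih.step hD

/-- If two lines arrive from both sides at the same chord, and one of them can be rotated past
it, then so can the other. -/
lemma Pivot.swap_of_pivot {p q : ℤ} (h : W.Pivot (p, q)) (h' : W.Pivot (q + 1, p - 1)) :
    W.Pivot (q + 1, p) := by
  by_contra hc
  have := h'.prev_of_not (by simpa using hc)
  rw [sub_add_cancel] at this
  have h1 := W.next_prev (q + 1)
  have h2 := prev_lt (W := W) p
  have h3 := W.lt_next p
  have hw := h.window
  simp only at hw
  unfold Pivot at h
  simp only at h
  rcases this with e | e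
  · rw [← e] at h1
    omega
  · have h4 : W.next p = W.next (W.prev (q + 1)) + W.n := by rw [e, W.next_add]
    rw [W.next_prev] at h4
    omega

/-! ### The order of the lines of a given direction -/

/-- The position of the line of a state among the parallel lines: twice the difference of the labels
of its two ends, one of which is the pivot `p` and the other one has the label `q + 1 / 2`. -/
def pos (s : ℤ × ℤ) : ℤ := |2 * (s.2 - s.1) + 1|

lemma pos_of_lt {s : ℤ × ℤ} (h : s.1 < s.2) : pos s = 2 * (s.2 - s.1) + 1 :=
  abs_of_pos (by omega)

lemma pos_of_gt {s : ℤ × ℤ} (h : s.2 < s.1) : pos s = 2 * (s.1 - s.2) - 1 := by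
  unfold pos; rw [abs_of_neg (by omega)]; ring

lemma pos_flip {s : ℤ × ℤ} (h : W.Pivot s) : pos (W.flip s) = 2 * W.n - pos s := by
  have hw := h.window
  unfold flip
  split_ifs with hlt
  · rw [pos_of_gt (s := (s.1 + W.n, s.2)) (by simp only; omega), pos_of_lt hlt]; simp only; ring
  · rw [pos_of_lt (s := (s.1, s.2 + W.n)) (by simp only; omega), pos_of_gt (by omega)]
    simp only; ring

lemma eq_of_pos_eq {s t : ℤ × ℤ} (hs : W.Pivot s) (ht : W.Pivot t)
    (hsum : s.1 + s.2 = t.1 + t.2) (h : pos s = pos t) : s = t := by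
  have ws := hs.window
  have wt := ht.window
  have : s.1 = t.1 ∧ s.2 = t.2 := by
    rcases ws with ws | ws <;> rcases wt with wt | wt
    · rw [pos_of_lt ws.1, pos_of_lt wt.1] at h; omega
    · rw [pos_of_lt ws.1, pos_of_gt (by omega)] at h; omega
    · rw [pos_of_gt (by omega), pos_of_lt wt.1] at h; omega
    · rw [pos_of_gt (by omega), pos_of_gt (by omega)] at h; omega
  exact Prod.ext this.1 this.2

lemma Pivot.step_cases (D : Set (Sym2 α)) {s : ℤ × ℤ} (h : W.Pivot s) :
    (s.1 < s.2 ∧ W.step D s = (s.1, s.2 + 1) ∧ W.Pivot (s.1, s.2 + 1) ∧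
      W.chord (s.1, s.2 + 1) ∉ D ∧ pos (W.step D s) = pos s + 2) ∨
    (s.2 + 1 < s.1 ∧ W.step D s = (s.1, s.2 + 1) ∧ W.Pivot (s.1, s.2 + 1) ∧
      W.chord (s.1, s.2 + 1) ∉ D ∧ pos (W.step D s) = pos s - 2) ∨
    (¬ (W.Pivot (s.1, s.2 + 1) ∧ W.chord (s.1, s.2 + 1) ∉ D) ∧ W.step D s = (s.2 + 1, s.1) ∧
      pos (W.step D s) = pos s) := by
  have hw := h.window
  by_cases hc : W.Pivot (s.1, s.2 + 1) ∧ W.chord (s.1, s.2 + 1) ∉ D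
  · have e : W.step D s = (s.1, s.2 + 1) := if_pos hc
    rcases hw with hw | hw
    · refine .inl ⟨hw.1, e, hc.1, hc.2, ?_⟩
      rw [e, pos_of_lt hw.1, pos_of_lt (s := (s.1, s.2 + 1)) (by simp only; omega)]; simp only; ring
    · refine .inr (.inl ⟨hw.1, e, hc.1, hc.2, ?_⟩)
      have h1 : s.2 < s.1 := by omega
      rw [e, pos_of_gt h1, pos_of_gt (s := (s.1, s.2 + 1)) (by simp only; omega)]
      simp only; ring
  · have e : W.step D s = (s.2 + 1, s.1) := if_neg hc
    refine .inr (.inr ⟨hc, e, ?_⟩)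
    rw [e]
    rcases hw with hw | hw
    · rw [pos_of_lt hw.1, pos_of_gt (s := (s.2 + 1, s.1)) (by simp only; omega)]; simp only; ring
    · have h1 : s.2 < s.1 := by omega
      rw [pos_of_gt h1, pos_of_lt (s := (s.2 + 1, s.1)) (by simp only; omega)]
      simp only; ring

/-- The order of two parallel lines changes only where both are rotated past the chord joining
their pivots. -/
lemma swap_of_pos_lt {D : Set (Sym2 α)} {s t : ℤ × ℤ} (hs : W.Pivot s) (ht : W.Pivot t)
    (hsum : s.1 + s.2 = t.1 + t.2) (h : pos s < pos t)
    (h' : pos (W.step D t) ≤ pos (W.step D s)) :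
    W.step D s = (W.step D t).swap ∧ W.chord (W.step D s) ∉ D := by
  have ps : (s.1 < s.2 ∧ pos s = 2 * (s.2 - s.1) + 1) ∨
      (s.2 < s.1 ∧ pos s = 2 * (s.1 - s.2) - 1) := by
    rcases hs.window with w | w
    · exact .inl ⟨w.1, pos_of_lt w.1⟩
    · exact .inr ⟨by omega, pos_of_gt (by omega)⟩
  have pt : (t.1 < t.2 ∧ pos t = 2 * (t.2 - t.1) + 1) ∨
      (t.2 < t.1 ∧ pos t = 2 * (t.1 - t.2) - 1) := by
    rcases ht.window with w | w
    · exact .inl ⟨w.1, pos_of_lt w.1⟩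
    · exact .inr ⟨by omega, pos_of_gt (by omega)⟩
  obtain ⟨p, q⟩ := s
  obtain ⟨p', q'⟩ := t
  simp only at ps pt hsum
  rcases hs.step_cases D with ⟨a1, a2, a3, a4, a5⟩ | ⟨a1, a2, a3, a4, a5⟩ | ⟨a1, a2, a5⟩ <;>
  rcases ht.step_cases D with ⟨b1, b2, b3, b4, b5⟩ | ⟨b1, b2, b3, b4, b5⟩ | ⟨b1, b2, b5⟩ <;>
  simp only at a1 b1 <;> try omega
  · have e1 : p' = q + 1 := by omega
    have e2 : q' = p - 1 := by omega
    subst e1 e2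
    refine ⟨by rw [a2, b2]; simp, by rw [a2]; exact a4⟩
  · have e1 : p' = q + 1 := by omega
    have e2 : q' = p - 1 := by omega
    subst e1 e2
    exfalso
    simp only [sub_add_cancel] at b1
    refine b1 ⟨hs.swap_of_pivot ht, ?_⟩
    rw [chord_mk_swap]; exact a4
  · have e1 : p = q' + 1 := by omega
    have e2 : q = p' - 1 := by omega
    subst e1 e2
    exfalso
    simp only [sub_add_cancel] at a1
    refine a1 ⟨ht.swap_of_pivot hs, ?_⟩
    rw [chord_mk_swap]; exact b4

lemma step_injOn {D : Set (Sym2 α)} {s t : ℤ × ℤ} (hs : W.Pivot s) (ht : W.Pivot t)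
    (h : W.step D s = W.step D t) : s = t := by
  have hsum : s.1 + s.2 = t.1 + t.2 := by
    have h1 := step_sum (W := W) D s
    have h2 := step_sum (W := W) D t
    rw [h] at h1
    omega
  rcases lt_trichotomy (pos s) (pos t) with hlt | he | hlt
  · have := (swap_of_pos_lt (D := D) hs ht hsum hlt (by rw [h])).1
    rw [h] at this
    have h1 := congrArg Prod.fst this
    simp only [Prod.fst_swap] at h1
    have h2 := step_sum (W := W) D t
    rcases hs.step_cases D with ⟨a1, a2, a3, a4, a5⟩ | ⟨a1, a2, a3, a4, a5⟩ | ⟨a1, a2, a5⟩ <;>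
    rcases ht.step_cases D with ⟨b1, b2, b3, b4, b5⟩ | ⟨b1, b2, b3, b4, b5⟩ | ⟨b1, b2, b5⟩ <;>
    rw [b2] at h1 <;> simp only at h1 <;> have := ht.window <;> omega
  · exact eq_of_pos_eq hs ht hsum he
  · have := (swap_of_pos_lt (D := D) ht hs hsum.symm hlt (by rw [h])).1
    rw [h] at this
    have h1 := congrArg Prod.fst this
    simp only [Prod.fst_swap] at h1
    have h2 := step_sum (W := W) D t
    rcases ht.step_cases D with ⟨b1, b2, b3, b4, b5⟩ | ⟨b1, b2, b3, b4, b5⟩ | ⟨b1, b2, b5⟩ <;>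
    rw [b2] at h1 <;> simp only at h1 <;> have := ht.window <;> omega

lemma iterate_step_injOn {D : Set (Sym2 α)} (hD : D ⊆ W.diagonals) {s t : ℤ × ℤ}
    (hs : W.Pivot s) (ht : W.Pivot t) {k : ℕ} (h : (W.step D)^[k] s = (W.step D)^[k] t) :
    s = t := by
  induction k with
  | zero => exact h
  | succ k ih =>
    rw [Function.iterate_succ_apply', Function.iterate_succ_apply'] at h
    exact ih (step_injOn (hs.iterate hD k) (ht.iterate hD k) h)

end Unrolling

namespace Unrolling

variable {α : Type*} {W : Unrolling α}

/-! ### Half-turns -/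

lemma Pivot.flip {s : ℤ × ℤ} (h : W.Pivot s) : W.Pivot (W.flip s) := by
  have hw := h.window
  unfold Unrolling.flip
  split_ifs with hlt
  · exact h.congr (by simp) (by simp) (by simp only; omega) (by simp only; omega)
  · exact h.congr (by simp) (by simp) (by simp only; omega) (by simp only; omega)

lemma Pivot.exists_flip_eq {s : ℤ × ℤ} (h : W.Pivot s) : ∃ t, W.Pivot t ∧ W.flip t = s := by
  have hw := h.window
  unfold Unrolling.flip
  rcases hw with hw | hw
  · refine ⟨(s.1, s.2 - W.n), h.congr (by simp) (by simp) (by simp only; omega)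
      (by simp only; omega), ?_⟩
    rw [if_neg (by simp only; omega)]; simp
  · refine ⟨(s.1 - W.n, s.2), h.congr (by simp) (by simp) (by simp only; omega)
      (by simp only; omega), ?_⟩
    rw [if_pos (by simp only; omega)]; simp

lemma flip_sum (s : ℤ × ℤ) : (W.flip s).1 + (W.flip s).2 = s.1 + s.2 + W.n := by
  unfold flip; split_ifs <;> simp only <;> ring

lemma flip_injOn {s t : ℤ × ℤ} (hs : W.Pivot s) (ht : W.Pivot t)
    (h : W.flip s = W.flip t) : s = t := by
  have ws := hs.window
  have wt := ht.window
  obtain ⟨p, q⟩ := s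
  obtain ⟨p', q'⟩ := t
  unfold flip at h
  simp only at h ws wt
  split_ifs at h <;> simp only [Prod.mk.injEq] at h ⊢ <;> omega

lemma step_of_pass {D : Set (Sym2 α)} {p q : ℤ}
    (h : W.Pivot (p, q + 1) ∧ W.chord (p, q + 1) ∉ D) : W.step D (p, q) = (p, q + 1) := if_pos h

lemma step_of_bounce {D : Set (Sym2 α)} {p q : ℤ}
    (h : ¬ (W.Pivot (p, q + 1) ∧ W.chord (p, q + 1) ∉ D)) : W.step D (p, q) = (q + 1, p) :=
  if_neg h

lemma step_flip (D : Set (Sym2 α)) {s : ℤ × ℤ} (h : W.Pivot s) :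
    W.step D (W.flip s) = W.flip (W.step D s) := by
  have hw := h.window
  obtain ⟨p, q⟩ := s
  simp only at hw
  rcases hw with hw | hw
  · have e : W.flip (p, q) = (p + W.n, q) := if_pos hw.1
    have hP : W.Pivot (p + W.n, q + 1) ↔ W.Pivot (p, q + 1) :=
      ⟨fun h ↦ h.congr (by simp) (by simp) (by simp only; omega) (by simp only; omega),
        fun h ↦ h.congr (by simp) (by simp) (by simp only; omega) (by simp only; omega)⟩
    have hc : W.chord (p + W.n, q + 1) = W.chord (p, q + 1) :=
      chord_eq_iff.2 (.inl ⟨by simp, by simp⟩)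
    rw [e]
    by_cases hcond : W.Pivot (p, q + 1) ∧ W.chord (p, q + 1) ∉ D
    · rw [step_of_pass hcond, step_of_pass (by rwa [hP, hc])]
      exact (if_pos (by simp only; omega)).symm
    · rw [step_of_bounce hcond, step_of_bounce (by rwa [hP, hc])]
      exact (if_neg (by simp only; omega)).symm
  · have e : W.flip (p, q) = (p, q + W.n) := if_neg (by simp only; omega)
    have hP : W.Pivot (p, q + W.n + 1) ↔ W.Pivot (p, q + 1) :=
      ⟨fun h ↦ h.congr (by simp) ⟨-1, by simp⟩ (by simp only; omega) (by simp only; omega),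
        fun h ↦ h.congr (by simp) ⟨1, by simp⟩ (by simp only; omega) (by simp only; omega)⟩
    have hc : W.chord (p, q + W.n + 1) = W.chord (p, q + 1) :=
      chord_eq_iff.2 (.inl ⟨by simp, ⟨1, by simp⟩⟩)
    rw [e]
    by_cases hcond : W.Pivot (p, q + 1) ∧ W.chord (p, q + 1) ∉ D
    · rw [step_of_pass hcond, step_of_pass (by rwa [hP, hc]), add_right_comm]
      exact (if_neg (by simp only; omega)).symm
    · rw [step_of_bounce hcond, step_of_bounce (by rwa [hP, hc]), add_right_comm]
      exact (if_pos (by simp only; omega)).symm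

lemma iterate_step_flip {D : Set (Sym2 α)} (hD : D ⊆ W.diagonals) {s : ℤ × ℤ} (h : W.Pivot s)
    (k : ℕ) : (W.step D)^[k] (W.flip s) = W.flip ((W.step D)^[k] s) := by
  induction k with
  | zero => rfl
  | succ k ih => rw [Function.iterate_succ_apply', ih, Function.iterate_succ_apply',
      step_flip D (h.iterate hD k)]

/-! ### Strands and their crossings -/

variable (W) in
/-- The admissible states of direction `0`, used as names of the lines swept out from them: in
one half-turn, each star contributes exactly one such line. -/
def strands : Set (ℤ × ℤ) := {s | W.Pivot s ∧ s.1 + s.2 = 0}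

lemma strands_finite : (strands W).Finite := by
  refine ((Set.finite_Icc (-(W.n : ℤ)) W.n).prod (Set.finite_Icc (-(W.n : ℤ)) W.n)).subset ?_
  rintro ⟨p, q⟩ ⟨h, h0⟩
  have hw := h.window
  simp only [Set.mem_prod, Set.mem_Icc] at h0 hw ⊢
  omega

lemma Closed.exists_strand {D : Set (Sym2 α)} (hD : D ⊆ W.diagonals) (hc : W.Closed D)
    {s : ℤ × ℤ} (hs : W.Pivot s) {t : ℕ} (ht : t ≤ W.n) (hsum : s.1 + s.2 = t) :
    ∃ x ∈ strands W, (W.step D)^[t] x = s := by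
  obtain ⟨x, hx, e⟩ := (hs.iterate hD (W.n - t)).exists_flip_eq
  have h1 := flip_sum (W := W) x
  rw [e, iterate_step_sum, hsum] at h1
  refine ⟨x, ⟨hx, by omega⟩, flip_injOn (hx.iterate hD t) hs ?_⟩
  rw [← iterate_step_flip hD hx, e, ← Function.iterate_add_apply, Nat.add_sub_cancel' ht, hc s hs]

/-- It suffices to check that the strands close up. -/
lemma Closed.of_strands {D : Set (Sym2 α)} (hD : D ⊆ W.diagonals)
    (h : ∀ x ∈ strands W, (W.step D)^[W.n] x = W.flip x) : W.Closed D := by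
  have hn := n_pos (W := W)
  -- By induction on `k`, the claim holds for all states of direction `k * n`.
  have key : ∀ (k : ℤ) (s : ℤ × ℤ), W.Pivot s → s.1 + s.2 = k * W.n →
      (W.step D)^[W.n] s = W.flip s := by
    intro k
    induction k using Int.induction_on with
    | zero => intro s hs h0; exact h s ⟨hs, by simpa using h0⟩
    | succ k ih =>
      intro s hs hk
      obtain ⟨t, ht, rfl⟩ := hs.exists_flip_eq
      have := flip_sum (W := W) t
      rw [iterate_step_flip hD ht, ih t ht (by rw [hk] at this; linarith)]
    | pred k ih =>
      intro s hs hk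
      have := flip_sum (W := W) s
      have h2 := ih (W.flip s) hs.flip (by rw [this, hk]; ring)
      rw [iterate_step_flip hD hs] at h2
      exact flip_injOn (hs.iterate hD _) hs.flip h2
  intro s hs
  -- The line of `s` reaches a direction divisible by `n`.
  obtain ⟨m, k, hm⟩ : ∃ (m : ℕ) (k : ℤ), s.1 + s.2 + m = k * W.n := by
    refine ⟨(-(s.1 + s.2) % W.n).toNat, -(-(s.1 + s.2) / W.n), ?_⟩
    rw [Int.toNat_of_nonneg (Int.emod_nonneg _ (by omega))]
    have := Int.emod_add_mul_ediv (-(s.1 + s.2)) W.n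
    linarith
  have h1 := key k ((W.step D)^[m] s) (hs.iterate hD m) (by rw [iterate_step_sum, hm])
  rw [← Function.iterate_add_apply, add_comm, Function.iterate_add_apply,
    ← iterate_step_flip hD hs] at h1
  exact iterate_step_injOn hD (hs.iterate hD _) hs.flip h1

/-- Any two strands cross, because their order is reversed by a half-turn. -/
lemma Closed.exists_crossing {D : Set (Sym2 α)} (hD : D ⊆ W.diagonals) (hc : W.Closed D)
    {x y : ℤ × ℤ} (hx : W.Pivot x) (hy : W.Pivot y) (hsum : x.1 + x.2 = y.1 + y.2)
    (hne : x ≠ y) : ∃ t, 1 ≤ t ∧ t ≤ W.n ∧ (W.step D)^[t] x = ((W.step D)^[t] y).swap ∧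
      W.chord ((W.step D)^[t] x) ∉ D := by
  wlog hlt : pos x < pos y generalizing x y
  · have hlt' : pos y < pos x :=
      lt_of_le_of_ne (not_lt.1 hlt) fun h ↦ hne (eq_of_pos_eq hx hy hsum h.symm)
    obtain ⟨t, h1, h2, h3, h4⟩ := this hy hx hsum.symm hne.symm hlt'
    refine ⟨t, h1, h2, by rw [h3, Prod.swap_swap], ?_⟩
    rw [h3, chord_swap] at h4
    exact h4
  by_contra! hcon
  have key : ∀ t ≤ W.n, pos ((W.step D)^[t] x) < pos ((W.step D)^[t] y) := by
    intro t
    induction t with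
    | zero => intro _; exact hlt
    | succ t ih =>
      intro ht
      by_contra hle
      rw [Function.iterate_succ_apply', Function.iterate_succ_apply'] at hle
      obtain ⟨h1, h2⟩ := swap_of_pos_lt (hx.iterate hD t) (hy.iterate hD t)
        (by rw [iterate_step_sum, iterate_step_sum, hsum]) (ih (by omega)) (not_lt.1 hle)
      rw [← Function.iterate_succ_apply' (W.step D), ← Function.iterate_succ_apply' (W.step D)] at h1
      rw [← Function.iterate_succ_apply' (W.step D)] at h2
      exact h2 (hcon (t + 1) (by omega) ht h1)
  have := key W.n le_rfl
  rw [hc x hx, hc y hy, pos_flip hx, pos_flip hy] at this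
  omega

/-- The strands `x` and `y` with `z = s(x, y)` run into the diagonal `d` from both sides, where
they touch (if `d ∈ D`) or cross (if `d ∉ D`). -/
def Meet (W : Unrolling α) (D : Set (Sym2 α)) (d : Sym2 α) (z : Sym2 (ℤ × ℤ)) : Prop :=
  ∃ (x y s : ℤ × ℤ) (t : ℕ), x ∈ strands W ∧ y ∈ strands W ∧ 1 ≤ t ∧ t ≤ W.n ∧
    (W.step D)^[t] x = s ∧ (W.step D)^[t] y = s.swap ∧ d = W.chord s ∧ z = s(x, y)

variable (W) in
/-- The unordered pairs of distinct strands. -/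
def strandPairs : Set (Sym2 (ℤ × ℤ)) :=
  {z | ∃ x ∈ strands W, ∃ y ∈ strands W, x ≠ y ∧ z = s(x, y)}

lemma strandPairs_finite : (strandPairs W).Finite := by
  refine ((strands_finite (W := W)).prod (strands_finite (W := W))).image (fun p ↦ s(p.1, p.2)) |>.subset ?_
  rintro z ⟨x, hx, y, hy, -, rfl⟩
  exact ⟨(x, y), ⟨hx, hy⟩, rfl⟩

/-- Every diagonal has a representative whose direction lies in `[1, n]`. -/
lemma exists_representative {d : Sym2 α} (hd : d ∈ W.diagonals) :
    ∃ (s : ℤ × ℤ) (t : ℕ), W.Pivot s ∧ W.Pivot s.swap ∧ d = W.chord s ∧ 1 ≤ t ∧ t ≤ W.n ∧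
      s.1 + s.2 = t := by
  have hn := n_pos (W := W)
  obtain ⟨⟨p, q⟩, h1, h2, e⟩ := hd
  wlog hlt : p < q generalizing p q
  · have hw := h1.window
    exact this q p h2 h1 (by rw [e, chord_mk_swap]) (by simp only at hw; omega)
  have hw := h1.window
  simp only at hw
  -- Translating both points by `k * n` changes the direction by `2 * k * n`.
  set m : ℤ := (p + q - 1) / (2 * W.n) with hm
  have hm1 := Int.emod_add_mul_ediv (p + q - 1) (2 * W.n)
  have hm2 := Int.emod_nonneg (p + q - 1) (b := 2 * W.n) (by omega)
  have hm3 := Int.emod_lt_of_pos (p + q - 1) (b := 2 * W.n) (by omega)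
  rw [← hm] at hm1
  have d1 : (W.n : ℤ) ∣ (p - m * W.n) - p := ⟨-m, by ring⟩
  have d2 : (W.n : ℤ) ∣ (q - m * W.n) - q := ⟨-m, by ring⟩
  have hs : p - m * W.n + (q - m * W.n) = (p + q - 1) % (2 * W.n) + 1 := by linarith
  by_cases hle : (p + q - 1) % (2 * W.n) + 1 ≤ W.n
  · refine ⟨(p - m * W.n, q - m * W.n), ((p + q - 1) % (2 * W.n) + 1).toNat,
      h1.congr d1 d2 (by simp only; omega) (by simp only; omega),
      h2.congr d2 d1 (by simp only [Prod.fst_swap, Prod.snd_swap]; omega)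
        (by simp only [Prod.fst_swap, Prod.snd_swap]; omega),
      by rw [e]; exact (chord_eq_iff.2 (.inl ⟨d1, d2⟩)).symm, by omega, by omega, ?_⟩
    simp only; omega
  · have d3 : (W.n : ℤ) ∣ (q - m * W.n - W.n) - q := ⟨-m - 1, by ring⟩
    refine ⟨(p - m * W.n, q - m * W.n - W.n), ((p + q - 1) % (2 * W.n) + 1 - W.n).toNat,
      h1.congr d1 d3 (by simp only; omega) (by simp only; omega),
      h2.congr d3 d1 (by simp only [Prod.fst_swap, Prod.snd_swap]; omega)
        (by simp only [Prod.fst_swap, Prod.snd_swap]; omega),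
      by rw [e]; exact (chord_eq_iff.2 (.inl ⟨d1, d3⟩)).symm, by omega, by omega, ?_⟩
    simp only; omega

/-- The directions of two representatives of the same chord are congruent modulo `n`. -/
lemma sum_eq_of_chord_eq {s s' : ℤ × ℤ} (h : W.chord s = W.chord s') {t t' : ℕ}
    (hs : s.1 + s.2 = t) (hs' : s'.1 + s'.2 = t') (h1 : 1 ≤ t) (h2 : t ≤ W.n) (h1' : 1 ≤ t')
    (h2' : t' ≤ W.n) : t = t' := by
  have hd : (W.n : ℤ) ∣ (t : ℤ) - t' := by
    rw [← hs, ← hs']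
    rcases chord_eq_iff.1 h with ⟨⟨i, hi⟩, ⟨j, hj⟩⟩ | ⟨⟨i, hi⟩, ⟨j, hj⟩⟩ <;>
      exact ⟨i + j, by rw [mul_add, ← hi, ← hj]; ring⟩
  have := Int.eq_zero_of_abs_lt_dvd hd (abs_lt.2 ⟨by omega, by omega⟩)
  omega

variable (W) in
open Classical in
/-- The direction in `[1, n]` at which a diagonal is swept over. -/
noncomputable def time (d : Sym2 α) : ℕ :=
  if h : d ∈ W.diagonals then (exists_representative h).choose_spec.choose else 0

lemma time_chord {s : ℤ × ℤ} {t : ℕ} (hs : W.Pivot s) (hs' : W.Pivot s.swap)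
    (hsum : s.1 + s.2 = t) (h1 : 1 ≤ t) (h2 : t ≤ W.n) : W.time (W.chord s) = t := by
  have h : W.chord s ∈ W.diagonals := ⟨s, hs, hs', rfl⟩
  rw [time, dif_pos h]
  obtain ⟨-, -, e, h3, h4, h5⟩ := (exists_representative h).choose_spec.choose_spec
  exact (sum_eq_of_chord_eq e hsum h5 h1 h2 h3 h4).symm

lemma Closed.exists_meet {D : Set (Sym2 α)} (hD : D ⊆ W.diagonals) (hc : W.Closed D)
    {d : Sym2 α} (hd : d ∈ W.diagonals) : ∃ z ∈ strandPairs W, Meet W D d z := by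
  obtain ⟨s, t, h1, h2, h3, h4, h5, h6⟩ := exists_representative hd
  obtain ⟨x, hx, ex⟩ := hc.exists_strand hD h1 h5 h6
  obtain ⟨y, hy, ey⟩ := hc.exists_strand hD h2 h5 (by simp; linarith)
  refine ⟨s(x, y), ⟨x, hx, y, hy, ?_, rfl⟩, x, y, s, t, hx, hy, h4, h5, ex, ey, h3, rfl⟩
  rintro rfl
  have hw := h1.window
  have := congrArg Prod.fst (ex.symm.trans ey)
  simp only [Prod.fst_swap] at this
  omega

lemma Meet.time_eq {D : Set (Sym2 α)} (hD : D ⊆ W.diagonals) {x y s : ℤ × ℤ} {t : ℕ}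
    (hx : x ∈ strands W) (hy : y ∈ strands W) (h1 : 1 ≤ t) (h2 : t ≤ W.n)
    (ex : (W.step D)^[t] x = s) (ey : (W.step D)^[t] y = s.swap) : W.time (W.chord s) = t := by
  refine time_chord (ex ▸ hx.1.iterate hD t) (ey ▸ hy.1.iterate hD t) ?_ h1 h2
  rw [← ex, iterate_step_sum, hx.2, zero_add]

lemma Meet.mem_diagonals {D : Set (Sym2 α)} (hD : D ⊆ W.diagonals) {d : Sym2 α}
    {z : Sym2 (ℤ × ℤ)} (h : Meet W D d z) : d ∈ W.diagonals := by
  obtain ⟨x, y, s, t, hx, hy, h1, h2, ex, ey, rfl, rfl⟩ := h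
  exact ⟨s, ex ▸ hx.1.iterate hD t, ey ▸ hy.1.iterate hD t, rfl⟩

/-- The pair of strands that meet at a diagonal is unique. -/
lemma Meet.unique {D : Set (Sym2 α)} (hD : D ⊆ W.diagonals) {d : Sym2 α}
    {z z' : Sym2 (ℤ × ℤ)} (h : Meet W D d z) (h' : Meet W D d z') : z = z' := by
  obtain ⟨x, y, s, t, hx, hy, h1, h2, ex, ey, rfl, rfl⟩ := h
  obtain ⟨x', y', s', t', hx', hy', h1', h2', ex', ey', e, rfl⟩ := h'
  have ht : t = t' := by
    rw [← Meet.time_eq hD hx hy h1 h2 ex ey, e, Meet.time_eq hD hx' hy' h1' h2' ex' ey']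
  subst ht
  have hs : W.Pivot s := ex ▸ hx.1.iterate hD t
  have hs' : W.Pivot s' := ex' ▸ hx'.1.iterate hD t
  have hsum : s.1 + s.2 = s'.1 + s'.2 := by
    rw [← ex, ← ex', iterate_step_sum, iterate_step_sum, hx.2, hx'.2]
  rcases eq_or_eq_swap_of_chord_eq hs hs' hsum e with rfl | rfl
  · rw [iterate_step_injOn hD hx.1 hx'.1 (ex.trans ex'.symm),
      iterate_step_injOn hD hy.1 hy'.1 (ey.trans ey'.symm)]
  · rw [iterate_step_injOn hD hx.1 hy'.1 (ex.trans ey'.symm),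
      iterate_step_injOn hD hy.1 hx'.1 (ey.trans (by simp [ex'])), Sym2.eq_swap]

lemma Closed.exists_meet_notMem {D : Set (Sym2 α)} (hD : D ⊆ W.diagonals) (hc : W.Closed D)
    {z : Sym2 (ℤ × ℤ)} (hz : z ∈ strandPairs W) : ∃ d ∈ W.diagonals \ D, Meet W D d z := by
  obtain ⟨x, hx, y, hy, hne, rfl⟩ := hz
  obtain ⟨t, h1, h2, h3, h4⟩ := hc.exists_crossing hD hx.1 hy.1 (by rw [hx.2, hy.2]) hne
  have hm : Meet W D (W.chord ((W.step D)^[t] x)) s(x, y) :=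
    ⟨x, y, _, t, hx, hy, h1, h2, rfl, by rw [h3, Prod.swap_swap], rfl, rfl⟩
  exact ⟨_, ⟨hm.mem_diagonals hD, h4⟩, hm⟩

lemma diagonals_finite : W.diagonals.Finite := by
  refine (((Set.finite_Icc (-2 * (W.n : ℤ)) (2 * W.n)).prod
    (Set.finite_Icc (-2 * (W.n : ℤ)) (2 * W.n))).image W.chord).subset ?_
  intro d hd
  obtain ⟨⟨p, q⟩, t, h, -, e, h1, h2, h3⟩ := exists_representative hd
  have hw := h.window
  refine ⟨(p, q), ?_, e.symm⟩
  simp only [Set.mem_prod, Set.mem_Icc] at hw h3 ⊢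
  omega

/-- Any two strands cross only once. -/
def Tight (W : Unrolling α) (D : Set (Sym2 α)) : Prop :=
  ∀ z d d', d ∉ D → d' ∉ D → Meet W D d z → Meet W D d' z → d = d'

/-- Whether any two strands cross only once depends only on the number of diagonals. -/
lemma Closed.tight_iff {D : Set (Sym2 α)} (hD : D ⊆ W.diagonals) (hc : W.Closed D) :
    W.Tight D ↔ (W.diagonals \ D).ncard ≤ (strandPairs W).ncard := by
  classical
  have hex : ∀ d ∈ W.diagonals \ D, ∃ z ∈ strandPairs W, Meet W D d z :=
    fun d hd ↦ hc.exists_meet hD hd.1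
  choose f hf hm using hex
  have hsurj : ∀ z ∈ strandPairs W, ∃ d, ∃ hd : d ∈ W.diagonals \ D, f d hd = z := by
    intro z hz
    obtain ⟨d, hd, hdz⟩ := hc.exists_meet_notMem hD hz
    exact ⟨d, hd, (hm d hd).unique hD hdz⟩
  constructor
  · intro ht
    refine Set.ncard_le_ncard_of_injOn (fun d ↦ if hd : d ∈ W.diagonals \ D then f d hd else
      s((0, 0), (0, 0))) ?_ ?_ strandPairs_finite
    · intro d hd
      simp only [dif_pos hd]
      exact hf d hd
    · intro d hd d' hd' e
      beta_reduce at e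
      rw [dif_pos hd, dif_pos hd'] at e
      exact ht _ d d' hd.2 hd'.2 (hm d hd) (by rw [e]; exact hm d' hd')
  · intro hcard z d d' hd hd' hdz hdz'
    have h1 : d ∈ W.diagonals \ D := ⟨hdz.mem_diagonals hD, hd⟩
    have h1' : d' ∈ W.diagonals \ D := ⟨hdz'.mem_diagonals hD, hd'⟩
    refine Set.inj_on_of_surj_on_of_ncard_le f hf (fun z hz ↦ ?_) hcard h1 h1' ?_
      (diagonals_finite.subset Set.sdiff_subset)
    · obtain ⟨d, hd, e⟩ := hsurj z hz
      exact ⟨d, hd, e⟩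
    · rw [(hm d h1).unique hD hdz, (hm d' h1').unique hD hdz']

/-! ### Exchanging crossings and contacts -/

/-- Exchanging whether two given strands cross or touch at two diagonals where they meet does not
affect the way in which strands close up: between the two diagonals, the two strands exchange
their roles. -/
lemma Closed.toggle {D D' : Set (Sym2 α)} (hD : D ⊆ W.diagonals) (hD' : D' ⊆ W.diagonals)
    (hc : W.Closed D) {d₁ d₂ : Sym2 α} {z : Sym2 (ℤ × ℤ)} (h₁ : Meet W D d₁ z)
    (h₂ : Meet W D d₂ z) (hne : d₁ ≠ d₂)
    (hdiff : ∀ d, (d ∈ D' ↔ d ∈ D) ↔ ¬ (d = d₁ ∨ d = d₂)) : W.Closed D' := by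
  classical
  obtain ⟨x, y, s₁, t₁, hx, hy, l₁, u₁, x₁, y₁, rfl, rfl⟩ := h₁
  obtain ⟨s₂, t₂, l₂, u₂, x₂, y₂, rfl⟩ : ∃ (s₂ : ℤ × ℤ) (t₂ : ℕ), 1 ≤ t₂ ∧ t₂ ≤ W.n ∧
      (W.step D)^[t₂] x = s₂ ∧ (W.step D)^[t₂] y = s₂.swap ∧ d₂ = W.chord s₂ := by
    obtain ⟨x', y', s₂, t₂, hx', hy', l₂, u₂, x₂, y₂, rfl, e⟩ := h₂
    rcases Sym2.eq_iff.1 e with ⟨rfl, rfl⟩ | ⟨rfl, rfl⟩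
    · exact ⟨s₂, t₂, l₂, u₂, x₂, y₂, rfl⟩
    · exact ⟨s₂.swap, t₂, l₂, u₂, y₂, by simp [x₂], by simp⟩
  clear h₂
  wlog hlt : t₁ < t₂ generalizing t₁ t₂ s₁ s₂
  · refine this s₂ t₂ l₂ u₂ x₂ y₂ s₁ t₁ l₁ u₁ x₁ y₁ hne.symm (fun d ↦ ?_) ?_
    · rw [hdiff]; tauto
    · rcases (not_lt.1 hlt).lt_or_eq with h | h
      · exact h
      · subst h; exact absurd (by rw [← x₁, ← x₂]) hne
  -- On the diagonals in question the two step functions differ by exchanging the pivot.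
  have hstep : ∀ s, W.Pivot s → W.step D' s =
      if W.chord (W.step D s) = W.chord s₁ ∨ W.chord (W.step D s) = W.chord s₂ then
        (W.step D s).swap else W.step D s := by
    intro s hs
    have hch : W.chord (W.step D s) = W.chord (s.1, s.2 + 1) := by
      rcases hs.step_cases D with h | h | h
      · rw [h.2.1]
      · rw [h.2.1]
      · rw [h.2.1, chord_mk_swap]
    rw [hch]
    have hd := hdiff (W.chord (s.1, s.2 + 1))
    split_ifs with h
    · have hP : W.Pivot (s.1, s.2 + 1) := by
        have hw := hs.window
        refine (pivot_of_chord_mem (s := (s.1, s.2 + 1)) ?_ (by simp only; omega)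
          (by simp only; omega)).1
        rcases h with h | h <;> rw [h]
        · exact ⟨s₁, x₁ ▸ hx.1.iterate hD _, y₁ ▸ hy.1.iterate hD _, rfl⟩
        · exact ⟨s₂, x₂ ▸ hx.1.iterate hD _, y₂ ▸ hy.1.iterate hD _, rfl⟩
      unfold step
      simp only [hP, true_and]
      by_cases hm : W.chord (s.1, s.2 + 1) ∈ D
      · rw [if_pos (by tauto), if_neg (by tauto), Prod.swap_prod_mk]
      · rw [if_neg (by tauto), if_pos (by tauto), Prod.swap_prod_mk]
    · have : W.chord (s.1, s.2 + 1) ∈ D' ↔ W.chord (s.1, s.2 + 1) ∈ D := by tauto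
      unfold step
      simp only [this]
  -- A strand runs into the given diagonals only if it is `x` or `y`.
  have hhit : ∀ w ∈ strands W, ∀ (t tᵢ : ℕ) (s : ℤ × ℤ), 1 ≤ t → t ≤ W.n → 1 ≤ tᵢ → tᵢ ≤ W.n →
      (W.step D)^[tᵢ] x = s → (W.step D)^[tᵢ] y = s.swap →
      (W.chord ((W.step D)^[t] w) = W.chord s ↔ t = tᵢ ∧ (w = x ∨ w = y)) := by
    intro w hw t tᵢ s h1 h2 h3 h4 ex ey
    constructor
    · intro e
      have hsx : s.1 + s.2 = tᵢ := by rw [← ex, iterate_step_sum, hx.2, zero_add]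
      have hsw : ((W.step D)^[t] w).1 + ((W.step D)^[t] w).2 = t := by
        rw [iterate_step_sum, hw.2, zero_add]
      have ht : t = tᵢ := sum_eq_of_chord_eq e hsw hsx h1 h2 h3 h4
      subst ht
      refine ⟨rfl, ?_⟩
      rcases eq_or_eq_swap_of_chord_eq (hw.1.iterate hD t) (ex ▸ hx.1.iterate hD t)
        (by rw [hsw, hsx]) e with h | h
      · exact .inl (iterate_step_injOn hD hw.1 hx.1 (h.trans ex.symm))
      · exact .inr (iterate_step_injOn hD hw.1 hy.1 (h.trans ey.symm))
    · rintro ⟨rfl, rfl | rfl⟩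
      · rw [ex]
      · rw [ey, chord_swap]
  let σ : ℕ → ℤ × ℤ → ℤ × ℤ := fun t w ↦
    if t₁ ≤ t ∧ t < t₂ then Equiv.swap x y w else w
  have hσ : ∀ t, ∀ w ∈ strands W, σ t w ∈ strands W := by
    intro t w hw
    simp only [σ]
    split_ifs
    · rw [Equiv.swap_apply_def]; split_ifs <;> assumption
    · exact hw
  have key : ∀ w ∈ strands W, ∀ t ≤ W.n, (W.step D')^[t] w = (W.step D)^[t] (σ t w) := by
    intro w hw t
    induction t with
    | zero =>
      intro _
      simp only [σ, Function.iterate_zero, id]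
      rw [if_neg (by omega)]
    | succ t ih =>
      intro ht
      have hσw := hσ t w hw
      rw [Function.iterate_succ_apply', ih (by omega), hstep _ (hσw.1.iterate hD t),
        ← Function.iterate_succ_apply' (W.step D)]
      simp only [Nat.succ_eq_add_one, hhit _ hσw _ _ _ (by omega) ht l₁ u₁ x₁ y₁,
        hhit _ hσw _ _ _ (by omega) ht l₂ u₂ x₂ y₂]
      have hxy : σ t w = x ∨ σ t w = y ↔ w = x ∨ w = y := by
        simp only [σ]
        split_ifs
        · rw [Equiv.swap_apply_eq_iff, Equiv.swap_apply_eq_iff, Equiv.swap_apply_left,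
            Equiv.swap_apply_right, or_comm]
        · rfl
      simp only [hxy]
      by_cases hwxy : w = x ∨ w = y
      · by_cases ht1 : t + 1 = t₁
        · have e1 : σ t w = w := if_neg (by omega)
          have e2 : σ (t + 1) w = Equiv.swap x y w := if_pos (by omega)
          rw [if_pos (by tauto), e1, e2, ht1]
          rcases hwxy with rfl | rfl
          · rw [Equiv.swap_apply_left, x₁, y₁]
          · rw [Equiv.swap_apply_right, x₁, y₁, Prod.swap_swap]
        · by_cases ht2 : t + 1 = t₂
          · have e1 : σ t w = Equiv.swap x y w := if_pos (by omega)
            have e2 : σ (t + 1) w = w := if_neg (by omega)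
            rw [if_pos (by tauto), e1, e2, ht2]
            rcases hwxy with rfl | rfl
            · rw [Equiv.swap_apply_left, x₂, y₂, Prod.swap_swap]
            · rw [Equiv.swap_apply_right, x₂, y₂]
          · rw [if_neg (by tauto)]
            congr 1
            simp only [σ]
            congr 1
            rw [eq_iff_iff]
            omega
      · rw [if_neg (by tauto)]
        congr 1
        have : Equiv.swap x y w = w := Equiv.swap_apply_of_ne_of_ne (by tauto) (by tauto)
        simp [σ, this]
  refine .of_strands hD' fun w hw ↦ ?_
  rw [key w hw W.n le_rfl, show σ W.n w = w from if_neg (by omega)]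
  exact hc w hw.1

/-- If two strands cross more than once, then two of the crossings can be turned into contacts. -/
lemma Closed.tight_of_maximal {D : Set (Sym2 α)} (hD : D ⊆ W.diagonals) (hc : W.Closed D)
    (hmax : ∀ D', D ⊂ D' → D' ⊆ W.diagonals → ¬ W.Closed D') : W.Tight D := by
  intro z d d' hd hd' hm hm'
  by_contra hne
  have hD' : insert d (insert d' D) ⊆ W.diagonals :=
    Set.insert_subset (hm.mem_diagonals hD) (Set.insert_subset (hm'.mem_diagonals hD) hD)
  refine hmax _ ?_ hD' (hc.toggle hD hD' hm hm' hne fun e ↦ ?_)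
  · exact (Set.ssubset_iff_of_subset fun e he ↦ .inr (.inr he)).2 ⟨d, .inl rfl, hd⟩
  · simp only [Set.mem_insert_iff]
    by_cases h1 : e = d
    · subst h1; tauto
    · by_cases h2 : e = d'
      · subst h2; tauto
      · tauto

/-- The steps towards directions where two sets of diagonals agree are the same. -/
lemma iterate_step_congr {D D' : Set (Sym2 α)} (hD : D ⊆ W.diagonals) (hD' : D' ⊆ W.diagonals)
    {t : ℕ} (h : ∀ d ∈ W.diagonals, t < W.time d → (d ∈ D ↔ d ∈ D')) {s : ℤ × ℤ}
    (hs : W.Pivot s) (hsum : s.1 + s.2 = t) (k : ℕ) (hk : t + k ≤ W.n) :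
    (W.step D)^[k] s = (W.step D')^[k] s := by
  classical
  induction k with
  | zero => rfl
  | succ k ih =>
    rw [Function.iterate_succ_apply', Function.iterate_succ_apply', ← ih (by omega)]
    have hP := hs.iterate hD k
    have hS := iterate_step_sum (W := W) D s k
    set u := (W.step D)^[k] s
    have hw := hP.window
    have : W.chord (u.1, u.2 + 1) ∈ D ↔ W.chord (u.1, u.2 + 1) ∈ D' := by
      by_cases hd : W.chord (u.1, u.2 + 1) ∈ W.diagonals
      · obtain ⟨h1, h2⟩ := pivot_of_chord_mem hd (by simp only; omega) (by simp only; omega)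
        refine h _ hd ?_
        rw [time_chord (t := t + k + 1) h1 h2 (by simp only; push_cast; omega) (by omega)
          (by omega)]
        omega
      · exact ⟨fun h ↦ absurd (hD h) hd, fun h ↦ absurd (hD' h) hd⟩
    unfold step
    simp only [this]

/-- The exchange step: if a contact `d` of `D` is a crossing for `D'`, and both sets agree at all
later directions, then the two strands of `D` that touch at `d` cross at an earlier direction, for
otherwise the two strands of `D'` that cross at `d` would cross again. -/
lemma exists_exchange {D D' : Set (Sym2 α)} (hD : D ⊆ W.diagonals) (hc : W.Closed D)
    (ht : W.Tight D) (hD' : D' ⊆ W.diagonals) (hc' : W.Closed D') (ht' : W.Tight D')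
    {d : Sym2 α} (hd : d ∈ D) (hd' : d ∉ D')
    (hagree : ∀ e ∈ W.diagonals, W.time d < W.time e → (e ∈ D ↔ e ∈ D')) :
    ∃ r ∈ W.diagonals, r ∉ D ∧ W.time r < W.time d ∧
      W.Closed (insert r (D \ {d})) ∧ W.Tight (insert r (D \ {d})) := by
  obtain ⟨z, hz, hm⟩ := hc.exists_meet hD (hD hd)
  obtain ⟨r, ⟨hr, hrD⟩, hmr⟩ := hc.exists_meet_notMem hD hz
  have hne : r ≠ d := fun h ↦ hrD (h ▸ hd)
  have hDr : insert r (D \ {d}) ⊆ W.diagonals :=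
    Set.insert_subset hr (Set.sdiff_subset.trans hD)
  have hcr : W.Closed (insert r (D \ {d})) := by
    refine hc.toggle hD hDr hmr hm hne fun e ↦ ?_
    simp only [Set.mem_insert_iff, Set.mem_sdiff, Set.mem_singleton_iff]
    by_cases h1 : e = r
    · subst h1; tauto
    · by_cases h2 : e = d
      · subst h2; tauto
      · tauto
  refine ⟨r, hr, hrD, ?_, hcr, ?_⟩
  · by_contra! hle
    obtain ⟨x, y, s, t, hx, hy, l, u, ex, ey, rfl, rfl⟩ := hm
    obtain ⟨s', t', l', u', ex', ey', rfl⟩ : ∃ (s' : ℤ × ℤ) (t' : ℕ), 1 ≤ t' ∧ t' ≤ W.n ∧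
        (W.step D)^[t'] x = s' ∧ (W.step D)^[t'] y = s'.swap ∧ r = W.chord s' := by
      obtain ⟨x', y', s', t', hx', hy', l', u', ex', ey', rfl, e⟩ := hmr
      rcases Sym2.eq_iff.1 e with ⟨rfl, rfl⟩ | ⟨rfl, rfl⟩
      · exact ⟨s', t', l', u', ex', ey', rfl⟩
      · exact ⟨s'.swap, t', l', u', ey', by simp [ex'], by simp⟩
    have hts := Meet.time_eq hD hx hy l u ex ey
    have hts' := Meet.time_eq hD hx hy l' u' ex' ey'
    rw [hts, hts'] at hle
    have hlt : t < t' := by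
      refine lt_of_le_of_ne hle fun h ↦ hne ?_
      subst h
      rw [← ex, ← ex']
    -- The strands of `D'` through the contact `d` follow those of `D` from there on.
    have hP : W.Pivot s := ex ▸ hx.1.iterate hD t
    have hP' : W.Pivot s.swap := ey ▸ hy.1.iterate hD t
    have hs : s.1 + s.2 = t := by rw [← ex, iterate_step_sum, hx.2, zero_add]
    have hs' : s.swap.1 + s.swap.2 = t := by simp; linarith
    rw [hts] at hagree
    obtain ⟨x₂, hx₂, ex₂⟩ := hc'.exists_strand hD' hP u hs
    obtain ⟨y₂, hy₂, ey₂⟩ := hc'.exists_strand hD' hP' u hs'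
    have hcont : ∀ (v v₂ q q' : ℤ × ℤ), W.Pivot q → q.1 + q.2 = t → (W.step D)^[t] v = q →
        (W.step D')^[t] v₂ = q → (W.step D)^[t'] v = q' → (W.step D')^[t'] v₂ = q' := by
      intro v v₂ q q' hq hqs h1 h2 h3
      have e : t' = t' - t + t := by omega
      rw [e, Function.iterate_add_apply, h1] at h3
      rw [e, Function.iterate_add_apply, h2,
        ← iterate_step_congr hD hD' hagree hq hqs _ (by omega), h3]
    have hr' : W.chord s' ∉ D' := by
      rw [← hagree _ hr (by omega)]
      exact hrD
    refine hne (ht' s(x₂, y₂) _ _ hr' hd' ?_ ?_)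
    · exact ⟨x₂, y₂, s', t', hx₂, hy₂, l', u', hcont x x₂ s s' hP hs ex ex₂ ex',
        hcont y y₂ _ _ hP' hs' ey ey₂ ey', rfl, rfl⟩
    · exact ⟨x₂, y₂, s, t, hx₂, hy₂, l, u, ex₂, ey₂, rfl, rfl⟩
  · rw [hcr.tight_iff hDr]
    rw [hc.tight_iff hD] at ht
    have e : W.diagonals \ insert r (D \ {d}) = insert d ((W.diagonals \ D) \ {r}) := by
      ext e
      have := hD hd
      simp only [Set.mem_sdiff, Set.mem_insert_iff, Set.mem_singleton_iff]
      by_cases h2 : e = d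
      · subst h2; tauto
      · tauto
    rw [e, Set.ncard_exchange (show d ∉ W.diagonals \ D from fun h ↦ h.2 hd)
      (show r ∈ W.diagonals \ D from ⟨hr, hrD⟩)]
    exact ht

/-- Replacing one diagonal by another one, where the strands close up before and after. -/
def Exchange (W : Unrolling α) (D D' : Set (Sym2 α)) : Prop :=
  D ⊆ W.diagonals ∧ D' ⊆ W.diagonals ∧ W.Closed D ∧ W.Closed D' ∧
    ∃ e ∈ D, ∃ f, f ∉ D ∧ D' = insert f (D \ {e})

lemma Exchange.symm {D D' : Set (Sym2 α)} (h : W.Exchange D D') : W.Exchange D' D := by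
  obtain ⟨h1, h2, h3, h4, e, he, f, hf, rfl⟩ := h
  refine ⟨h2, h1, h4, h3, f, .inl rfl, e, ?_, ?_⟩
  · rintro (h | h)
    · exact hf (h ▸ he)
    · exact h.2 rfl
  · ext d
    simp only [Set.mem_insert_iff, Set.mem_sdiff, Set.mem_singleton_iff]
    by_cases h1 : d = e
    · subst h1; tauto
    · by_cases h2 : d = f
      · subst h2; tauto
      · tauto

open Classical in
/-- Tight sets are connected by exchanges.  Each exchange replaces a diagonal in which the two sets
differ by an earlier one, so the weight `∑ 2 ^ time` of their symmetric difference decreases. -/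
theorem exchange_connected {D₁ D₂ : Set (Sym2 α)} (h₁ : D₁ ⊆ W.diagonals) (c₁ : W.Closed D₁)
    (t₁ : W.Tight D₁) (h₂ : D₂ ⊆ W.diagonals) (c₂ : W.Closed D₂) (t₂ : W.Tight D₂) :
    Relation.ReflTransGen W.Exchange D₁ D₂ := by
  let L := (diagonals_finite (W := W)).toFinset
  let F : Set (Sym2 α) → Set (Sym2 α) → Finset (Sym2 α) := fun A B ↦ L.filter (· ∈ symmDiff A B)
  have hF : ∀ A B d, d ∈ F A B ↔ d ∈ W.diagonals ∧ ¬ (d ∈ A ↔ d ∈ B) := by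
    intro A B d
    simp only [F, L, Finset.mem_filter, Set.Finite.mem_toFinset, Set.mem_symmDiff]
    tauto
  let μ : Set (Sym2 α) → Set (Sym2 α) → ℕ := fun A B ↦ ∑ d ∈ F A B, 2 ^ W.time d
  have hdec : ∀ A B : Set (Sym2 α), A ⊆ W.diagonals → ∀ d ∈ A, d ∉ B → ∀ r ∈ W.diagonals, r ∉ A →
      W.time r < W.time d → μ (insert r (A \ {d})) B < μ A B := by
    intro A B hA d hd hdB r hr hrA hlt
    have hdF : d ∈ F A B := (hF A B d).2 ⟨hA hd, by tauto⟩
    have hsub : F (insert r (A \ {d})) B ⊆ insert r (((F A B).erase d).erase r) := by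
      intro e he
      simp only [hF, Set.mem_insert_iff, Set.mem_sdiff, Set.mem_singleton_iff,
        Finset.mem_insert, Finset.mem_erase] at he ⊢
      by_cases h1 : e = d
      · subst h1; tauto
      · by_cases h2 : e = r
        · exact .inl h2
        · tauto
    have h0 : 2 ^ W.time r < 2 ^ W.time d := Nat.pow_lt_pow_right (by norm_num) hlt
    have h1 := Finset.sum_le_sum_of_subset (f := fun e ↦ 2 ^ W.time e) hsub
    rw [Finset.sum_insert (Finset.notMem_erase r _)] at h1
    have h2 := Finset.sum_le_sum_of_subset (f := fun e ↦ 2 ^ W.time e)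
      (Finset.erase_subset r ((F A B).erase d))
    have h3 := Finset.add_sum_erase (F A B) (fun e ↦ 2 ^ W.time e) hdF
    simp only [μ] at h1 ⊢
    omega
  induction hN : μ D₁ D₂ using Nat.strong_induction_on generalizing D₁ D₂ with
  | _ N ih =>
  subst hN
  by_cases hne : (F D₁ D₂).Nonempty
  · obtain ⟨d, hd, hmax⟩ := Finset.exists_max_image _ W.time hne
    simp only [hF] at hd hmax
    have hagree : ∀ e ∈ W.diagonals, W.time d < W.time e → (e ∈ D₁ ↔ e ∈ D₂) := by
      intro e he hlt
      by_contra hc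
      exact absurd (hmax e ⟨he, hc⟩) (by omega)
    by_cases hd1 : d ∈ D₁
    · have hd2 : d ∉ D₂ := by tauto
      obtain ⟨r, hr, hr1, hlt, hc, ht⟩ := exists_exchange h₁ c₁ t₁ h₂ c₂ t₂ hd1 hd2 hagree
      have hsub : insert r (D₁ \ {d}) ⊆ W.diagonals :=
        Set.insert_subset hr (Set.sdiff_subset.trans h₁)
      exact .head ⟨h₁, hsub, c₁, hc, d, hd1, r, hr1, rfl⟩
        (ih _ (hdec D₁ D₂ h₁ d hd1 hd2 r hr hr1 hlt) hsub hc ht h₂ c₂ t₂ rfl)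
    · have hd2 : d ∈ D₂ := by tauto
      obtain ⟨r, hr, hr2, hlt, hc, ht⟩ := exists_exchange h₂ c₂ t₂ h₁ c₁ t₁ hd2 hd1
        fun e he hlt ↦ (hagree e he hlt).symm
      have hsub : insert r (D₂ \ {d}) ⊆ W.diagonals :=
        Set.insert_subset hr (Set.sdiff_subset.trans h₂)
      have hμ : μ D₁ (insert r (D₂ \ {d})) < μ D₁ D₂ := by
        have hsymm : ∀ A B, μ A B = μ B A := fun A B ↦ by simp only [μ, F, symmDiff_comm]
        rw [hsymm, hsymm D₁]
        exact hdec D₂ D₁ h₂ d hd2 hd1 r hr hr2 hlt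
      exact .tail (ih _ hμ h₁ c₁ t₁ hsub hc ht rfl)
        (Exchange.symm ⟨h₂, hsub, c₂, hc, d, hd2, r, hr2, rfl⟩)
  · have : D₁ = D₂ := by
      ext d
      by_contra hc
      refine hne ⟨d, ?_⟩
      refine (hF _ _ _).2 ⟨?_, hc⟩
      by_cases hd1 : d ∈ D₁
      · exact h₁ hd1
      · exact h₂ (by tauto)
    rw [this]

end Unrolling

/-! ### Points on a circle -/

lemma Anticlockwise.rotate {u v w : ℂ} (h : Anticlockwise u v w) : Anticlockwise v w u := by
  unfold Anticlockwise at *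
  simp only [Complex.sub_re, Complex.sub_im] at *
  linarith

lemma Anticlockwise.asymm {u v w : ℂ} (h : Anticlockwise u v w) : ¬ Anticlockwise u w v := by
  unfold Anticlockwise at *; linarith

lemma Anticlockwise.ne₁₂ {u v w : ℂ} (h : Anticlockwise u v w) : u ≠ v := by
  rintro rfl; simp [Anticlockwise] at h

lemma Anticlockwise.ne₂₃ {u v w : ℂ} (h : Anticlockwise u v w) : v ≠ w := h.rotate.ne₁₂

lemma Anticlockwise.ne₁₃ {u v w : ℂ} (h : Anticlockwise u v w) : u ≠ w := h.rotate.ne₂₃.symm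

/-- A finite increasing sequence extends to a strictly increasing function on the integers that
grows by `c` over each period. -/
lemma exists_periodic_extension {R : Type*} [AddCommGroup R] [LinearOrder R] [IsOrderedAddMonoid R]
    {m : ℕ} (hm : 0 < m) {g : ℕ → R} {c : R} (hg : ∀ i, i + 1 < m → g i < g (i + 1))
    (hc : g (m - 1) < g 0 + c) :
    ∃ G : ℤ → R, StrictMono G ∧ (∀ i, G (i + m) = G i + c) ∧ ∀ i : ℕ, i < m → G i = g i := by
  refine ⟨fun i ↦ g (i % m).toNat + (i / m) • c, strictMono_int_of_lt_succ fun i ↦ ?_,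
    fun i ↦ ?_, fun i hi ↦ ?_⟩
  · have h0 := Int.emod_nonneg i (b := m) (by omega)
    have h1 := Int.emod_lt_of_pos i (b := m) (by omega)
    have h2 := Int.emod_add_mul_ediv i m
    by_cases h : i % m + 1 < m
    · have e1 : (i + 1) / (m : ℤ) = i / m :=
        Int.ediv_eq_iff_of_pos (by omega) |>.2 ⟨by linarith, by linarith⟩
      have e2 : (i + 1) % (m : ℤ) = i % m + 1 := by
        have := Int.emod_add_mul_ediv (i + 1) m
        rw [e1] at this; linarith
      rw [e1, e2, show (i % (m : ℤ) + 1).toNat = (i % (m : ℤ)).toNat + 1 by omega]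
      exact add_lt_add_left (hg _ (by omega)) _
    · have e0 : i % (m : ℤ) = m - 1 := by omega
      have e1 : (i + 1) / (m : ℤ) = i / m + 1 :=
        Int.ediv_eq_iff_of_pos (by omega) |>.2 ⟨by linarith, by linarith⟩
      have e2 : (i + 1) % (m : ℤ) = 0 := by
        have := Int.emod_add_mul_ediv (i + 1) m
        rw [e1] at this; linarith
      rw [e0, e1, e2, show ((m : ℤ) - 1).toNat = m - 1 by omega, add_smul, one_smul,
        add_comm _ c, ← add_assoc]
      exact add_lt_add_left hc _
  · beta_reduce
    rw [Int.add_emod_right, Int.add_ediv_of_dvd_right (dvd_refl _), Int.ediv_self (by omega),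
      add_smul, one_smul, add_assoc]
  · beta_reduce
    rw [Int.emod_eq_of_lt (by omega) (by omega), Int.ediv_eq_zero_of_lt (by omega) (by omega)]
    simp

/-- The point of the circle with centre `c` and radius `r` at the angle `a`. -/
noncomputable def circlePoint (c : ℂ) (r a : ℝ) : ℂ := ⟨c.re + r * Real.cos a, c.im + r * Real.sin a⟩

lemma circlePoint_arg (v c : ℂ) : circlePoint c (dist v c) (v - c).arg = v := by
  rw [dist_eq_norm]
  apply Complex.ext
  · simp [circlePoint, Complex.norm_mul_cos_arg]
  · simp [circlePoint, Complex.norm_mul_sin_arg]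

lemma anticlockwise_circlePoint (c : ℂ) {r x y z : ℝ} (hr : 0 < r) (hxy : x < y) (hyz : y < z)
    (hzx : z < x + 2 * Real.pi) :
    Anticlockwise (circlePoint c r x) (circlePoint c r y) (circlePoint c r z) := by
  set a := (y - x) / 2 with ha
  set b := (z - y) / 2 with hb
  have ey : y = x + 2 * a := by rw [ha]; ring
  have ez : z = x + 2 * (a + b) := by rw [ha, hb]; ring
  have key : (Real.cos y - Real.cos x) * (Real.sin z - Real.sin x) -
      (Real.sin y - Real.sin x) * (Real.cos z - Real.cos x) =
      4 * (Real.sin a * Real.sin b * Real.sin (a + b)) := by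
    have h1 : ∀ t, Real.cos (x + 2 * t) - Real.cos x = -2 * Real.sin t * Real.sin (x + t) := by
      intro t; rw [Real.cos_sub_cos]; ring_nf
    have h2 : ∀ t, Real.sin (x + 2 * t) - Real.sin x = 2 * Real.sin t * Real.cos (x + t) := by
      intro t; rw [Real.sin_sub_sin]; ring_nf
    have h3 : Real.sin b = Real.sin (x + (a + b)) * Real.cos (x + a) -
        Real.cos (x + (a + b)) * Real.sin (x + a) := by
      rw [← Real.sin_sub]; ring_nf
    rw [ey, ez, h1, h1, h2, h2, h3]; ring
  have hpos : 0 < Real.sin a * Real.sin b * Real.sin (a + b) := by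
    refine mul_pos (mul_pos ?_ ?_) ?_ <;> apply Real.sin_pos_of_pos_of_lt_pi <;> linarith
  have : (circlePoint c r y - circlePoint c r x).re * (circlePoint c r z - circlePoint c r x).im -
      (circlePoint c r y - circlePoint c r x).im * (circlePoint c r z - circlePoint c r x).re =
      r ^ 2 * (4 * (Real.sin a * Real.sin b * Real.sin (a + b))) := by
    rw [← key]; simp [circlePoint]; ring
  unfold Anticlockwise
  rw [this]
  positivity

lemma circlePoint_ne (c : ℂ) {r x y : ℝ} (hr : 0 < r) (hxy : x < y) (hyx : y < x + 2 * Real.pi) :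
    circlePoint c r x ≠ circlePoint c r y := by
  have h := anticlockwise_circlePoint c hr (x := x) (y := (x + y) / 2) (z := y)
    (by linarith) (by linarith) hyx
  exact h.ne₁₃

/-- Finitely many points on a circle can be enumerated periodically in anti-clockwise order. -/
lemma exists_anticlockwise_enumeration {V : Set ℂ} (hfin : V.Finite) (hne : V.Nonempty)
    (hcirc : ∃ (c : ℂ) (r : ℝ), 0 < r ∧ ∀ v ∈ V, dist v c = r) :
    ∃ (m : ℕ) (pt : ℤ → ℂ), 0 < m ∧ Set.range pt = V ∧ (∀ i j, pt i = pt j ↔ (m : ℤ) ∣ j - i) ∧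
      ∀ i j k : ℤ, i < j → j < k → k < i + m → Anticlockwise (pt i) (pt j) (pt k) := by
  obtain ⟨c, r, hr, hV⟩ := hcirc
  have hpt : ∀ v ∈ V, circlePoint c r (v - c).arg = v := fun v hv ↦ by
    rw [← hV v hv, circlePoint_arg]
  let A : Finset ℝ := hfin.toFinset.image fun v ↦ (v - c).arg
  have hA : ∀ a, a ∈ A ↔ ∃ v ∈ V, (v - c).arg = a := by simp [A]
  have hApi : ∀ a ∈ A, -Real.pi < a ∧ a ≤ Real.pi := by
    intro a ha
    obtain ⟨v, -, rfl⟩ := (hA a).1 ha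
    exact Complex.arg_mem_Ioc _
  set m := A.card with hm
  have hm0 : 0 < m := by
    obtain ⟨v, hv⟩ := hne
    exact Finset.card_pos.2 ⟨_, (hA _).2 ⟨v, hv, rfl⟩⟩
  let θ := A.orderEmbOfFin hm.symm
  have hθ : ∀ i, θ i ∈ A := fun i ↦ A.orderEmbOfFin_mem _ i
  obtain ⟨G, hG, hper, hGg⟩ := exists_periodic_extension (R := ℝ) hm0
    (g := fun i ↦ if h : i < m then θ ⟨i, h⟩ else 0) (c := 2 * Real.pi)
    (fun i hi ↦ by
      rw [dif_pos hi, dif_pos (by omega)]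
      exact θ.strictMono (Fin.mk_lt_mk.2 (by omega)))
    (by
      rw [dif_pos (by omega), dif_pos hm0]
      have h1 := hApi _ (hθ ⟨m - 1, by omega⟩)
      have h2 := hApi _ (hθ ⟨0, hm0⟩)
      linarith)
  have hper' : ∀ i k : ℤ, G (i + k * m) = G i + k * (2 * Real.pi) := by
    intro i k
    induction k using Int.induction_on with
    | zero => simp
    | succ k ih => rw [add_mul, one_mul, ← add_assoc, hper, ih]; push_cast; ring
    | pred k ih =>
      have := hper (i + (-(k : ℤ) - 1) * m)
      rw [show i + (-(k : ℤ) - 1) * m + m = i + -(k : ℤ) * m by ring, ih] at this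
      push_cast at this ⊢
      linarith
  have hptper : ∀ i k : ℤ, circlePoint c r (G (i + k * m)) = circlePoint c r (G i) := by
    intro i k
    rw [hper', circlePoint, circlePoint, Real.cos_add_int_mul_two_pi, Real.sin_add_int_mul_two_pi]
  have hmod : ∀ i : ℤ, circlePoint c r (G i) = circlePoint c r (G ((i % m).toNat : ℤ)) := by
    intro i
    rw [Int.toNat_of_nonneg (Int.emod_nonneg _ (by omega))]
    conv_lhs => rw [← Int.emod_add_mul_ediv i m, mul_comm, hptper]
  have hlt : ∀ i : ℤ, (i % m).toNat < m := fun i ↦ by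
    have := Int.emod_lt_of_pos i (b := m) (by omega)
    omega
  refine ⟨m, fun i ↦ circlePoint c r (G i), hm0, ?_, fun i j ↦ ⟨fun h ↦ ?_, ?_⟩, ?_⟩
  · ext v
    constructor
    · rintro ⟨i, rfl⟩
      beta_reduce
      rw [hmod, hGg _ (hlt i), dif_pos (hlt i)]
      obtain ⟨v, hv, e⟩ := (hA _).1 (hθ ⟨_, hlt i⟩)
      rw [← e, hpt v hv]
      exact hv
    · intro hv
      have : (v - c).arg ∈ Set.range θ := by
        rw [Finset.range_orderEmbOfFin]
        exact (hA _).2 ⟨v, hv, rfl⟩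
      obtain ⟨i, hi⟩ := this
      refine ⟨((i : ℕ) : ℤ), ?_⟩
      beta_reduce
      rw [hGg _ i.2, dif_pos i.2, hi, hpt v hv]
  · beta_reduce at h
    by_contra hnd
    have h0 := Int.emod_nonneg (j - i) (b := m) (by omega)
    have h1 := Int.emod_lt_of_pos (j - i) (b := m) (by omega)
    have h2 : (j - i) % m ≠ 0 := fun h ↦ hnd (Int.dvd_of_emod_eq_zero h)
    have h3 : circlePoint c r (G j) = circlePoint c r (G (i + (j - i) % m)) := by
      rw [← hptper (i + (j - i) % m) ((j - i) / m)]
      congr 2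
      have := Int.emod_add_mul_ediv (j - i) m
      linarith
    refine circlePoint_ne c hr (hG (show i < i + (j - i) % m by omega)) ?_ (h.trans h3)
    rw [← hper]
    exact hG (by omega)
  · rintro ⟨k, hk⟩
    beta_reduce
    rw [show j = i + k * m by linarith, hptper]
  · intro i j k hij hjk hki
    exact anticlockwise_circlePoint c hr (hG hij) (hG hjk) (by rw [← hper]; exact hG hki)

/-! ### Unrolling a cyclic polygon -/

/-- `W` is an unrolling of the cyclic polygon `P`. -/
structure Unrolling.Unrolls (W : Unrolling ℂ) (P : CyclicPolygon) : Prop where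
  range_pt : Set.range W.pt = P.V
  edge : ∀ i, (W.pt i, W.pt (W.next i)) ∈ P.E
  anticlockwise : ∀ i j k : ℤ, i < j → j < k → k < i + W.n → Anticlockwise (W.pt i) (W.pt j) (W.pt k)

lemma Unrolling.exists_rep {α : Type*} (W : Unrolling α) (i j : ℤ) :
    ∃ j', i ≤ j' ∧ j' < i + W.n ∧ W.pt j' = W.pt j := by
  have hn := W.n_pos
  refine ⟨i + (j - i) % W.n, ?_, ?_, ?_⟩
  · have := Int.emod_nonneg (j - i) (b := W.n) (by omega); omega
  · have := Int.emod_lt_of_pos (j - i) (b := W.n) (by omega); omega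
  · rw [W.pt_eq_iff]
    refine ⟨(j - i) / W.n, ?_⟩
    have := Int.emod_add_mul_ediv (j - i) W.n
    linarith

lemma Unrolling.eq_of_pt_eq {α : Type*} {W : Unrolling α} {i j : ℤ} (h : W.pt i = W.pt j)
    (h1 : i < j + W.n) (h2 : j < i + W.n) : i = j := by
  have := Int.eq_zero_of_abs_lt_dvd ((W.pt_eq_iff i j).1 h) (abs_lt.2 ⟨by omega, by omega⟩)
  omega

lemma Unrolling.pt_add {α : Type*} (W : Unrolling α) (i : ℤ) : W.pt (i + W.n) = W.pt i :=
  (W.pt_eq_iff _ _).2 ⟨-1, by ring⟩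

lemma Unrolling.pt_sub {α : Type*} (W : Unrolling α) (i : ℤ) : W.pt (i - W.n) = W.pt i :=
  (W.pt_eq_iff _ _).2 ⟨1, by ring⟩

lemma CyclicPolygon.exists_unrolls (P : CyclicPolygon) (hV : P.V.Nonempty) :
    ∃ W : Unrolling ℂ, W.Unrolls P := by
  obtain ⟨m, pt, hm, hrange, heq, hac⟩ :=
    exists_anticlockwise_enumeration P.finite_V hV P.concyclic
  have hmem : ∀ i, pt i ∈ P.V := fun i ↦ hrange ▸ Set.mem_range_self i
  have hrep : ∀ v ∈ P.V, ∀ i : ℤ, ∃ j : ℤ, i ≤ j ∧ j < i + m ∧ pt j = v := by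
    intro v hv i
    rw [← hrange] at hv
    obtain ⟨j, rfl⟩ := hv
    refine ⟨i + (j - i) % m, ?_, ?_, ?_⟩
    · have := Int.emod_nonneg (j - i) (b := m) (by omega); omega
    · have := Int.emod_lt_of_pos (j - i) (b := m) (by omega); omega
    · rw [heq]
      refine ⟨(j - i) / m, ?_⟩
      have := Int.emod_add_mul_ediv (j - i) m
      linarith
  have hinj : ∀ i j, pt i = pt j → i < j + m → j < i + m → i = j := by
    intro i j h h1 h2
    have := Int.eq_zero_of_abs_lt_dvd ((heq i j).1 h) (abs_lt.2 ⟨by omega, by omega⟩)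
    omega
  have hper : ∀ i, pt (i + m) = pt i := fun i ↦ (heq _ _).2 ⟨-1, by ring⟩
  have hout : ∀ i : ℤ, ∃ j : ℤ, i < j ∧ j < i + m ∧ (pt i, pt j) ∈ P.E := by
    intro i
    obtain ⟨w, hw, -⟩ := P.existsUnique_out _ (hmem i)
    obtain ⟨u, hu, -⟩ := P.existsUnique_in _ (hmem i)
    obtain ⟨j, h1, h2, rfl⟩ := hrep w (P.snd_mem _ hw) i
    have hne := (P.anticlockwise _ _ _ hu hw).ne₂₃
    exact ⟨j, lt_of_le_of_ne h1 fun h ↦ hne (by rw [h]), h2, hw⟩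
  have hin : ∀ i : ℤ, ∃ j : ℤ, j < i ∧ i < j + m ∧ (pt j, pt i) ∈ P.E := by
    intro i
    obtain ⟨w, hw, -⟩ := P.existsUnique_out _ (hmem i)
    obtain ⟨u, hu, -⟩ := P.existsUnique_in _ (hmem i)
    obtain ⟨j, h1, h2, rfl⟩ := hrep u (P.fst_mem _ hu) (i - m)
    have hne := (P.anticlockwise _ _ _ hu hw).ne₁₂
    refine ⟨j, by omega, ?_, hu⟩
    by_contra hlt
    refine hne ?_
    rw [show j = i - m by omega, ← hper (i - m), sub_add_cancel]
  choose next hn1 hn2 hn3 using hout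
  choose prev hp1 hp2 hp3 using hin
  have hnext : ∀ i j : ℤ, i < j → j < i + m → (pt i, pt j) ∈ P.E → next i = j := fun i j h1 h2 h3 ↦
    hinj _ _ ((P.existsUnique_out _ (hmem i)).unique (hn3 i) h3)
      (by have := hn2 i; omega) (by have := hn1 i; omega)
  have hprev : ∀ i j : ℤ, j < i → i < j + m → (pt j, pt i) ∈ P.E → prev i = j := fun i j h1 h2 h3 ↦
    hinj _ _ ((P.existsUnique_in _ (hmem i)).unique (hp3 i) h3)
      (by have := hp1 i; omega) (by have := hp2 i; omega)
  refine ⟨⟨m, pt, heq, next, prev, fun i ↦ hnext _ _ (hp1 i) (hp2 i) (hp3 i),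
    fun i ↦ hprev _ _ (hn1 i) (hn2 i) (hn3 i), fun i ↦ ?_, fun i ↦ ?_, hn1, fun i ↦ ?_⟩,
    hrange, hn3, hac⟩
  · refine hnext _ _ (by linarith [hn1 i]) (by linarith [hn2 i]) ?_
    rw [hper, hper]; exact hn3 i
  · refine hprev _ _ (by linarith [hp1 i]) (by linarith [hp2 i]) ?_
    rw [hper, hper]; exact hp3 i
  · have h := P.anticlockwise _ _ _ (hp3 i) (hn3 i)
    by_contra hle
    have a1 := hn2 i
    have a2 := hp1 i
    have a3 := hp2 i
    rcases (not_lt.1 hle).eq_or_lt with he | hlt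
    · exact h.ne₁₃ (by rw [← he, hper])
    · have := hac i (prev i + m) (next i) (by omega) hlt a1
      rw [hper] at this
      exact this.asymm h.rotate

namespace Unrolling.Unrolls

variable {W : Unrolling ℂ} {P : CyclicPolygon}

lemma mem_V (h : W.Unrolls P) (i : ℤ) : W.pt i ∈ P.V := h.range_pt ▸ Set.mem_range_self i

lemma exists_rep (h : W.Unrolls P) {v : ℂ} (hv : v ∈ P.V) (i : ℤ) :
    ∃ j, i ≤ j ∧ j < i + W.n ∧ W.pt j = v := by
  rw [← h.range_pt] at hv
  obtain ⟨j, rfl⟩ := hv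
  exact W.exists_rep i j

lemma anticlockwise_iff (h : W.Unrolls P) {i j k : ℤ} (h1 : i < j) (h2 : j < i + W.n)
    (h3 : i < k) (h4 : k < i + W.n) : Anticlockwise (W.pt i) (W.pt j) (W.pt k) ↔ j < k := by
  constructor
  · intro ha
    by_contra hle
    rcases (not_lt.1 hle).eq_or_lt with rfl | hlt
    · exact ha.ne₂₃ rfl
    · exact (h.anticlockwise i k j h3 hlt h2).asymm ha
  · intro hlt
    exact h.anticlockwise i j k h1 hlt h4

lemma edge_iff (h : W.Unrolls P) {i j : ℤ} (h1 : i < j) (h2 : j < i + W.n) :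
    (W.pt i, W.pt j) ∈ P.E ↔ j = W.next i := by
  constructor
  · intro he
    refine eq_of_pt_eq ((P.existsUnique_out _ (h.mem_V i)).unique he (h.edge i)) ?_ ?_
    · have := W.lt_next i; omega
    · have := W.next_lt i; have := prev_lt (W := W) i; omega
  · rintro rfl; exact h.edge i

lemma edge_prev (h : W.Unrolls P) (i : ℤ) : (W.pt (W.prev i), W.pt i) ∈ P.E := by
  have := h.edge (W.prev i)
  rwa [W.next_prev] at this

lemma splitsAngleAt_iff (h : W.Unrolls P) {i j : ℤ} (h1 : i ≤ j) (h2 : j < i + W.n) :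
    P.SplitsAngleAt (W.pt i) (W.pt j) ↔ W.next i < j ∧ j < W.prev i + W.n := by
  have hi1 := prev_lt (W := W) i
  have hi2 := W.lt_next i
  have hi3 := W.next_lt i
  have hpt := W.pt_add (W.prev i)
  constructor
  · rintro ⟨a, b, ha, hb, hab, hb'⟩
    rw [(P.existsUnique_in _ (h.mem_V i)).unique ha (h.edge_prev i), ← hpt] at hab
    rw [(P.existsUnique_out _ (h.mem_V i)).unique hb (h.edge i)] at hb'
    have hij : i < j := lt_of_le_of_ne h1 fun e ↦ hb'.ne₁₃ (by rw [e])
    exact ⟨(h.anticlockwise_iff hi2 (by omega) hij h2).1 hb',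
      (h.anticlockwise_iff hij h2 (by omega) (by omega)).1 hab.rotate⟩
  · rintro ⟨h3, h4⟩
    refine ⟨_, _, h.edge_prev i, h.edge i, ?_, ?_⟩
    · rw [← hpt]
      exact (h.anticlockwise i j _ (by omega) h4 (by omega)).rotate.rotate
    · exact h.anticlockwise _ _ _ hi2 h3 h2

lemma isDiagonal_iff (h : W.Unrolls P) (d : Sym2 ℂ) : P.IsDiagonal d ↔ d ∈ W.diagonals := by
  have key : ∀ i j : ℤ, i < j → j < i + W.n → (P.Linkable (W.pt i) (W.pt j) ↔
      W.Pivot (i, j) ∧ W.Pivot (j, i)) := by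
    intro i j h1 h2
    have e := W.pt_add i
    have hs1 := h.splitsAngleAt_iff h1.le h2
    have hs2 := h.splitsAngleAt_iff (i := j) (j := i + W.n) (by omega) (by omega)
    rw [e] at hs2
    simp only [CyclicPolygon.Linkable, h.mem_V, true_and, hs1, hs2]
    have hi1 := prev_lt (W := W) i
    have hi2 := W.lt_next i
    have hj1 := prev_lt (W := W) j
    have hj2 := W.lt_next j
    unfold Pivot
    simp only
    constructor
    · intro h; omega
    · intro hP
      have c1 : j ≠ W.next i := by
        rintro rfl
        rw [W.prev_next] at hP hj1
        omega
      have c2 : i + W.n ≠ W.next j := by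
        intro e
        have := W.prev_next j
        rw [← e, W.prev_add] at this
        omega
      omega
  constructor
  · rintro ⟨u, v, hl, rfl⟩
    obtain ⟨i, hi⟩ : u ∈ Set.range W.pt := h.range_pt ▸ hl.1
    obtain ⟨j, h1, h2, rfl⟩ := h.exists_rep hl.2.1 i
    subst hi
    obtain ⟨a, b, -, -, -, hb'⟩ := hl.2.2.1
    have hij : i < j := lt_of_le_of_ne h1 fun e ↦ hb'.ne₁₃ (by rw [e])
    obtain ⟨hp, hp'⟩ := (key i j hij h2).1 hl
    exact ⟨(i, j), hp, hp', rfl⟩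
  · rintro ⟨⟨i, j⟩, hp, hp', rfl⟩
    rcases hp.window with hw | hw
    · exact ⟨_, _, (key i j hw.1 (by simp only at hw; omega)).2 ⟨hp, hp'⟩, rfl⟩
    · exact ⟨_, _, (key j i (by simp only at hw; omega) (by simp only at hw; omega)).2 ⟨hp', hp⟩,
        Sym2.eq_swap⟩

lemma edgeLength (h : W.Unrolls P) (i : ℤ) :
    (P.edgeLength (W.pt i, W.pt (W.next i)) : ℤ) = W.next i - i := by
  have hi1 := prev_lt (W := W) i
  have hi2 := W.lt_next i
  have hi3 := W.next_lt i
  have hset : {x ∈ P.V | Anticlockwise (W.pt i) x (W.pt (W.next i)) ∨ x = W.pt (W.next i)} =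
      W.pt '' Set.Ioc i (W.next i) := by
    ext x
    constructor
    · rintro ⟨hx, hx'⟩
      obtain ⟨j, h1, h2, rfl⟩ := h.exists_rep hx i
      rcases hx' with hx' | hx'
      · have hij : i < j := lt_of_le_of_ne h1 fun e ↦ hx'.ne₁₂ (by rw [e])
        exact ⟨j, ⟨hij, ((h.anticlockwise_iff hij h2 hi2 (by omega)).1 hx').le⟩, rfl⟩
      · exact ⟨_, ⟨hi2, le_rfl⟩, hx'.symm⟩
    · rintro ⟨j, ⟨h1, h2⟩, rfl⟩
      refine ⟨h.mem_V j, ?_⟩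
      rcases h2.eq_or_lt with rfl | hlt
      · exact .inr rfl
      · exact .inl (h.anticlockwise _ _ _ h1 hlt (by omega))
  have hinj : Set.InjOn W.pt (Set.Ioc i (W.next i)) := by
    intro a ha b hb hab
    simp only [Set.mem_Ioc] at ha hb
    exact eq_of_pt_eq hab (by omega) (by omega)
  unfold CyclicPolygon.edgeLength
  simp only [hset]
  rw [hinj.ncard_image, ← Finset.coe_Ioc, Set.ncard_coe_finset, Int.card_Ioc]
  omega

lemma ncard_V (h : W.Unrolls P) : P.V.ncard = W.n := by
  have hset : P.V = W.pt '' Set.Ico 0 (W.n : ℤ) := by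
    ext x
    constructor
    · intro hx
      obtain ⟨j, h1, h2, rfl⟩ := h.exists_rep hx 0
      exact ⟨j, ⟨h1, by omega⟩, rfl⟩
    · rintro ⟨j, -, rfl⟩; exact h.mem_V j
  have hinj : Set.InjOn W.pt (Set.Ico 0 (W.n : ℤ)) := by
    intro a ha b hb hab
    simp only [Set.mem_Ico] at ha hb
    exact eq_of_pt_eq hab (by omega) (by omega)
  rw [hset, hinj.ncard_image, ← Finset.coe_Ico, Set.ncard_coe_finset, Int.card_Ico]
  omega

lemma E_eq (h : W.Unrolls P) : P.E = Set.range fun i ↦ (W.pt i, W.pt (W.next i)) := by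
  ext ⟨u, v⟩
  constructor
  · intro he
    obtain ⟨i, rfl⟩ : u ∈ Set.range W.pt := h.range_pt ▸ P.fst_mem _ he
    exact ⟨i, by rw [(P.existsUnique_out _ (h.mem_V i)).unique he (h.edge i)]⟩
  · rintro ⟨i, hi⟩
    rw [← hi]
    exact h.edge i

end Unrolling.Unrolls

/-- The cyclic polygon encoded by an unrolling whose points lie in anti-clockwise order on a
circle. -/
def Unrolling.toCyclicPolygon (W : Unrolling ℂ)
    (hac : ∀ i j k : ℤ, i < j → j < k → k < i + W.n → Anticlockwise (W.pt i) (W.pt j) (W.pt k))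
    (hcirc : ∃ (c : ℂ) (r : ℝ), 0 < r ∧ ∀ v ∈ Set.range W.pt, dist v c = r) : CyclicPolygon where
  V := Set.range W.pt
  E := Set.range fun i ↦ (W.pt i, W.pt (W.next i))
  finite_V := by
    refine ((Set.finite_Ico 0 (W.n : ℤ)).image W.pt).subset ?_
    rintro _ ⟨i, rfl⟩
    obtain ⟨j, h1, h2, e⟩ := W.exists_rep 0 i
    exact ⟨j, ⟨h1, by omega⟩, e⟩
  concyclic := hcirc
  fst_mem := by rintro _ ⟨i, rfl⟩; exact ⟨i, rfl⟩
  snd_mem := by rintro _ ⟨i, rfl⟩; exact ⟨_, rfl⟩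
  existsUnique_in := by
    rintro _ ⟨i, rfl⟩
    refine ⟨W.pt (W.prev i), ⟨W.prev i, by simp [W.next_prev]⟩, ?_⟩
    rintro _ ⟨j, hj⟩
    obtain ⟨rfl, h⟩ := Prod.mk.inj hj
    rw [W.pt_eq_iff] at h ⊢
    obtain ⟨k, hk⟩ := h
    refine ⟨k, ?_⟩
    rw [show i = W.next j + k * W.n by linarith, prev_add_mul, W.prev_next]
    ring
  existsUnique_out := by
    rintro _ ⟨i, rfl⟩
    refine ⟨W.pt (W.next i), ⟨i, rfl⟩, ?_⟩
    rintro _ ⟨j, hj⟩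
    obtain ⟨h, rfl⟩ := Prod.mk.inj hj
    rw [W.pt_eq_iff] at h ⊢
    obtain ⟨k, hk⟩ := h
    refine ⟨k, ?_⟩
    rw [show i = j + k * W.n by linarith, next_add_mul]
    ring
  anticlockwise := by
    rintro u v w ⟨i, hi⟩ ⟨j, hj⟩
    obtain ⟨rfl, h⟩ := Prod.mk.inj hi
    obtain ⟨rfl, rfl⟩ := Prod.mk.inj hj
    obtain ⟨k, hk⟩ := (W.pt_eq_iff _ _).1 h
    have e : W.pt (W.next j) = W.pt (W.next (W.next i)) := by
      rw [W.pt_eq_iff]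
      refine ⟨-k, ?_⟩
      rw [show j = W.next i + k * W.n by linarith, next_add_mul]
      ring
    rw [e, ← h]
    have := W.next_lt (W.next i)
    rw [W.prev_next] at this
    exact hac _ _ _ (W.lt_next i) (W.lt_next _) this

lemma Unrolling.unrolls_toCyclicPolygon (W : Unrolling ℂ)
    (hac : ∀ i j k : ℤ, i < j → j < k → k < i + W.n → Anticlockwise (W.pt i) (W.pt j) (W.pt k))
    (hcirc : ∃ (c : ℂ) (r : ℝ), 0 < r ∧ ∀ v ∈ Set.range W.pt, dist v c = r) :
    W.Unrolls (W.toCyclicPolygon hac hcirc) where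
  range_pt := rfl
  edge i := ⟨i, rfl⟩
  anticlockwise := hac

/-! ### Star decompositions and half-turns -/

namespace Unrolling

variable {α : Type*} {W : Unrolling α}

variable (W) in
/-- The directed segment represented by a pair of integers. -/
def arrow (s : ℤ × ℤ) : α × α := (W.pt s.1, W.pt s.2)

@[simp] lemma arrow_flip (s : ℤ × ℤ) : W.arrow (W.flip s) = W.arrow s := by
  unfold flip arrow; split_ifs <;> simp [W.pt_add]

namespace Unrolls

variable {W : Unrolling ℂ} {P : CyclicPolygon} {D : Set (Sym2 ℂ)}

lemma arrow_out_mem_iff (h : W.Unrolls P) {i j : ℤ} (h1 : i < j) (h2 : j < i + W.n) :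
    W.arrow (i, j) ∈ P.subdividedEdges D ↔ j = W.next i ∨ W.chord (i, j) ∈ D := by
  rw [← h.edge_iff h1 h2]; rfl

lemma arrow_in_mem_iff (h : W.Unrolls P) {i j : ℤ} (h1 : i < j) (h2 : j < i + W.n) :
    W.arrow (j, i) ∈ P.subdividedEdges D ↔ j = W.prev i + W.n ∨ W.chord (i, j) ∈ D := by
  have e : W.arrow (j, i) = W.arrow (j, i + W.n) := by simp [arrow, W.pt_add]
  have hch : W.chord (j, i + W.n) = W.chord (i, j) := chord_eq_iff.2 (.inr ⟨by simp, by simp⟩)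
  rw [e, h.arrow_out_mem_iff h2 (by omega), hch]
  refine or_congr_left ⟨fun he ↦ ?_, fun he ↦ ?_⟩
  · have := W.prev_next j
    rw [← he, W.prev_add] at this
    exact this.symm
  · rw [he, W.next_add, W.next_prev]

/-- Where a segment of the subdivided polygon may lie in the angle at `i`. -/
lemma bounds (h : W.Unrolls P) (hD : D ⊆ W.diagonals) {i j : ℤ} (h1 : i < j) (h2 : j < i + W.n) :
    (W.arrow (i, j) ∈ P.subdividedEdges D → W.next i ≤ j ∧ j < W.prev i + W.n) ∧
    (W.arrow (j, i) ∈ P.subdividedEdges D → W.next i < j ∧ j ≤ W.prev i + W.n) := by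
  have hi := W.next_lt i
  have hi1 := W.lt_next i
  have hi2 := prev_lt (W := W) i
  have key : W.chord (i, j) ∈ D → W.next i < j ∧ j < W.prev i + W.n := by
    intro hc
    have hd := (h.isDiagonal_iff _).2 (hD hc)
    obtain ⟨hp, hp'⟩ := pivot_of_chord_mem (hD hc) (by simp only; omega) (by simp only; omega)
    have hj := prev_lt (W := W) j
    have hj' := W.lt_next j
    unfold Pivot at hp hp'
    simp only [Prod.swap_prod_mk] at hp hp'
    have : j ≠ W.next i := by
      rintro rfl
      rw [W.prev_next] at hp'
      omega
    omega
  rw [h.arrow_out_mem_iff h1 h2, h.arrow_in_mem_iff h1 h2]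
  constructor
  · rintro (rfl | hc)
    · omega
    · have := key hc; omega
  · rintro (rfl | hc)
    · omega
    · have := key hc; omega

/-- The line of the state `s`, when rotated about its pivot, arrives at `pt x` as the first
starting point of a segment of the subdivided polygon towards the pivot. -/
def FirstHit (W : Unrolling ℂ) (P : CyclicPolygon) (D : Set (Sym2 ℂ)) (s : ℤ × ℤ) (x : ℤ) : Prop :=
  s.2 < x ∧ W.arrow (x, s.1) ∈ P.subdividedEdges D ∧
    ∀ y, s.2 < y → y < x → W.arrow (y, s.1) ∉ P.subdividedEdges D

lemma FirstHit.unique {s : ℤ × ℤ} {x x' : ℤ} (h : FirstHit W P D s x) (h' : FirstHit W P D s x') :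
    x = x' := by
  rcases lt_trichotomy x x' with hlt | he | hlt
  · exact absurd h.2.1 (h'.2.2 x h.1 hlt)
  · exact he
  · exact absurd h'.2.1 (h.2.2 x' h'.1 hlt)

lemma arrow_mem_of_bounce (h : W.Unrolls P) {p q : ℤ} (hs : W.Pivot (p, q))
    (hc : ¬ (W.Pivot (p, q + 1) ∧ W.chord (p, q + 1) ∉ D)) :
    W.arrow (q + 1, p) ∈ P.subdividedEdges D := by
  by_cases hP : W.Pivot (p, q + 1)
  · right
    have : W.chord (p, q + 1) ∈ D := by tauto
    rwa [chord_mk_swap] at this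
  · left
    have := h.edge_prev p
    rcases hs.prev_of_not hP with e | e <;> rw [e]
    · exact this
    · simpa [arrow, W.pt_add] using this

lemma arrow_notMem_of_pass (h : W.Unrolls P) {p q : ℤ} (hs : W.Pivot (p, q))
    (hc : W.Pivot (p, q + 1) ∧ W.chord (p, q + 1) ∉ D) :
    W.arrow (q + 1, p) ∉ P.subdividedEdges D ∧ W.arrow (p, q + 1) ∉ P.subdividedEdges D := by
  obtain ⟨hP, hc⟩ := hc
  have hp1 := W.lt_next p
  have hp2 := prev_lt (W := W) p
  have hw := hs.window
  have hw' := hP.window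
  unfold Pivot at hs hP
  simp only at hs hP hw hw'
  rcases hw with hw | hw
  · rw [h.arrow_in_mem_iff (by omega) (by omega), h.arrow_out_mem_iff (by omega) (by omega)]
    constructor
    · rintro (e | e)
      · omega
      · exact hc e
    · rintro (e | e)
      · omega
      · exact hc e
  · have e1 : W.arrow (q + 1, p) = W.arrow (q + 1 + W.n, p) := by simp [arrow, W.pt_add]
    have e2 : W.arrow (p, q + 1) = W.arrow (p, q + 1 + W.n) := by simp [arrow, W.pt_add]
    have e3 : W.chord (p, q + 1 + W.n) = W.chord (p, q + 1) :=
      chord_eq_iff.2 (.inl ⟨by simp, by simp⟩)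
    rw [e1, e2, h.arrow_in_mem_iff (by omega) (by omega), h.arrow_out_mem_iff (by omega) (by omega),
      e3]
    constructor
    · rintro (e | e)
      · omega
      · exact hc e
    · rintro (e | e)
      · omega
      · exact hc e

lemma FirstHit.of_pass (h : W.Unrolls P) {p q x : ℤ} (hs : W.Pivot (p, q))
    (hc : W.Pivot (p, q + 1) ∧ W.chord (p, q + 1) ∉ D) (hx : FirstHit W P D (p, q + 1) x) :
    FirstHit W P D (p, q) x := by
  refine ⟨by have := hx.1; simp only at this ⊢; omega, hx.2.1, fun y h1 h2 ↦ ?_⟩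
  rcases (show q + 1 ≤ y from h1).eq_or_lt with rfl | hlt
  · exact (h.arrow_notMem_of_pass hs hc).1
  · exact hx.2.2 y hlt h2

lemma FirstHit.of_bounce (h : W.Unrolls P) {p q : ℤ} (hs : W.Pivot (p, q))
    (hc : ¬ (W.Pivot (p, q + 1) ∧ W.chord (p, q + 1) ∉ D)) : FirstHit W P D (p, q) (q + 1) :=
  ⟨by simp, h.arrow_mem_of_bounce hs hc, fun y h1 h2 ↦ by simp only at h1; omega⟩

/-- A rotating line arrives at some segment of the subdivided polygon.  The third clause says that
the pivot alternates between the smaller and the larger component of the state. -/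
lemma exists_firstHit (h : W.Unrolls P) (hD : D ⊆ W.diagonals) {s : ℤ × ℤ} (hs : W.Pivot s) :
    ∃ x, FirstHit W P D s x ∧ W.Pivot (x, s.1) ∧ (s.1 < s.2 ↔ s.1 < x) ∧
      ∃ N, (W.step D)^[N] s = (x, s.1) := by
  obtain ⟨p, q⟩ := s
  induction hk : (p + W.n - q).toNat generalizing q with
  | zero => have := hs.window; simp only at this; omega
  | succ k ih =>
    have hw := hs.window
    simp only at hw
    by_cases hc : W.Pivot (p, q + 1) ∧ W.chord (p, q + 1) ∉ D
    · obtain ⟨x, h1, h2, h3, N, h4⟩ := ih (q + 1) hc.1 (by omega)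
      refine ⟨x, h1.of_pass h hs hc, h2, ?_, N + 1, ?_⟩
      · rw [← h3]; simp only; omega
      · rw [Function.iterate_succ_apply, step_of_pass hc]; exact h4
    · refine ⟨q + 1, .of_bounce h hs hc, ?_, by simp only; omega, 1, step_of_bounce hc⟩
      have := hs.step hD
      rwa [step_of_bounce hc] at this

/-- Any segment of the subdivided polygon at which the rotating line arrives is the first one, or
is reached by continuing from the first one. -/
lemma exists_firstHit_of_mem (h : W.Unrolls P) {s : ℤ × ℤ} (hs : W.Pivot s) {N : ℕ} (hN : 0 < N)
    (hm : W.arrow ((W.step D)^[N] s) ∈ P.subdividedEdges D) :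
    ∃ x N', FirstHit W P D s x ∧ N' < N ∧ (W.step D)^[N'] (x, s.1) = (W.step D)^[N] s := by
  obtain ⟨p, q⟩ := s
  induction N generalizing q with
  | zero => omega
  | succ N ih =>
    rw [Function.iterate_succ_apply] at hm ⊢
    by_cases hc : W.Pivot (p, q + 1) ∧ W.chord (p, q + 1) ∉ D
    · rw [step_of_pass hc] at hm ⊢
      rcases Nat.eq_zero_or_pos N with rfl | hN
      · exact absurd hm (h.arrow_notMem_of_pass hs hc).2
      · obtain ⟨x, N', h1, h2, h3⟩ := ih hN (q + 1) hc.1 hm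
        exact ⟨x, N', h1.of_pass h hs hc, by omega, h3⟩
    · exact ⟨q + 1, N, .of_bounce h hs hc, by omega, by rw [step_of_bounce hc]⟩

lemma FirstHit.flip (hs : W.Pivot s) {x : ℤ} (hx : FirstHit W P D s x)
    (hlt : s.1 < s.2 ↔ s.1 < x) (hne : s.1 ≠ x) :
    FirstHit W P D (W.flip s) (W.flip (x, s.1)).1 := by
  have hw := hs.window
  obtain ⟨p, q⟩ := s
  obtain ⟨h1, h2, h3⟩ := hx
  simp only at hw hlt hne h1 h2 h3
  rcases hw with hw | hw
  · have e1 : W.flip (p, q) = (p + W.n, q) := if_pos hw.1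
    have e2 : W.flip (x, p) = (x, p + W.n) := if_neg (by simp only; omega)
    rw [e1, e2]
    refine ⟨h1, ?_, fun y h4 h5 ↦ ?_⟩
    · simpa [arrow, W.pt_add] using h2
    · simpa [arrow, W.pt_add] using h3 y h4 h5
  · have e1 : W.flip (p, q) = (p, q + W.n) := if_neg (by simp only; omega)
    have e2 : W.flip (x, p) = (x + W.n, p) := if_pos (by simp only; omega)
    rw [e1, e2]
    refine ⟨by simp only; omega, ?_, fun y h4 h5 ↦ ?_⟩
    · simpa [arrow, W.pt_add] using h2
    · have := h3 (y - W.n) (by simp only at h4; omega) (by simp only at h5; omega)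
      simpa [arrow, W.pt_sub] using this

/-- The successor function traces the rotating lines backwards. -/
lemma next_iff (h : W.Unrolls P) (hD : D ⊆ W.diagonals) {i j x : ℤ} (h1 : i < j) (h2 : j < x)
    (h3 : x < i + W.n) : P.Next D (W.arrow (x, i)) (W.arrow (i, j)) ↔
      W.arrow (i, j) ∈ P.subdividedEdges D ∧ FirstHit W P D (i, j) x := by
  constructor
  · rintro ⟨hx, hj, -, -, hno⟩
    refine ⟨hj, h2, hx, fun y h4 h5 hy ↦ ?_⟩
    simp only at h4
    rw [h.arrow_in_mem_iff (by omega) (by omega)] at hy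
    rcases hy with hy | hy
    · simp only at hy
      have := ((h.bounds hD (by omega) h3).2 hx).2
      omega
    · refine hno (W.pt y) hy ⟨?_, ?_⟩
      · exact (h.anticlockwise i y x (by omega) h5 h3).rotate.rotate
      · exact h.anticlockwise i j y h1 h4 (by omega)
  · rintro ⟨hj, -, hx, hno⟩
    refine ⟨hx, hj, rfl, (h.anticlockwise i j x h1 h2 h3).rotate.rotate, ?_⟩
    rintro z hz ⟨hz1, hz2⟩
    have hzV : z ∈ P.V := by
      obtain ⟨u, v, ⟨hu, hv, -⟩, e⟩ := (h.isDiagonal_iff _).2 (hD hz)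
      rcases Sym2.eq_iff.1 e with ⟨-, rfl⟩ | ⟨-, rfl⟩ <;> assumption
    obtain ⟨y, h4, h5, rfl⟩ := h.exists_rep hzV i
    have h4' : i < y := lt_of_le_of_ne h4 fun e ↦ hz2.ne₁₃ (by simp [arrow, e])
    have h6 : j < y := (h.anticlockwise_iff h1 (by omega) h4' h5).1 hz2
    have h7 : y < x := (h.anticlockwise_iff h4' h5 (by omega) h3).1 hz1.rotate
    exact hno y h6 h7 ((h.arrow_in_mem_iff h4' h5).2 (.inr hz))

lemma exists_rep_next (h : W.Unrolls P) (hD : D ⊆ W.diagonals) {u v : ℂ} {i : ℤ}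
    (hN : P.Next D (u, W.pt i) (W.pt i, v)) :
    ∃ j x : ℤ, i < j ∧ j < x ∧ x < i + W.n ∧ W.pt j = v ∧ W.pt x = u := by
  have hV : ∀ e ∈ P.subdividedEdges D, e.1 ∈ P.V ∧ e.2 ∈ P.V := by
    rintro e (he | he)
    · exact ⟨P.fst_mem _ he, P.snd_mem _ he⟩
    · obtain ⟨u, v, ⟨hu, hv, -⟩, e⟩ := (h.isDiagonal_iff _).2 (hD he)
      rcases Sym2.eq_iff.1 e with ⟨h1, h2⟩ | ⟨h1, h2⟩ <;> rw [h1, h2] <;> constructor <;> assumption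
  obtain ⟨hu, hv, -, hac, -⟩ := hN
  simp only at hac
  obtain ⟨j, h1, h2, rfl⟩ := h.exists_rep (hV _ hv).2 i
  obtain ⟨x, h3, h4, rfl⟩ := h.exists_rep (hV _ hu).1 i
  have h1' : i < j := lt_of_le_of_ne h1 fun e ↦ hac.ne₂₃ (by rw [e])
  have h3' : i < x := lt_of_le_of_ne h3 fun e ↦ hac.ne₁₂ (by rw [e])
  exact ⟨j, x, h1', (h.anticlockwise_iff h1' h2 h3' h4).1 hac.rotate, h4, rfl, rfl⟩

lemma next_unique (h : W.Unrolls P) (hD : D ⊆ W.diagonals) {e f f' : ℂ × ℂ} (hf : P.Next D e f)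
    (hf' : P.Next D e f') : f = f' := by
  obtain ⟨u, v⟩ := e
  obtain ⟨v₁, w⟩ := f
  obtain ⟨v₂, w'⟩ := f'
  obtain rfl : v₁ = v := hf.2.2.1
  obtain rfl : v₂ = v₁ := hf'.2.2.1
  have hv : v₂ ∈ P.V := by
    rcases hf.1 with he | he
    · exact P.snd_mem _ he
    · obtain ⟨a, b, ⟨ha, hb, -⟩, e⟩ := (h.isDiagonal_iff _).2 (hD he)
      rcases Sym2.eq_iff.1 e with ⟨-, rfl⟩ | ⟨-, rfl⟩ <;> assumption
  rw [← h.range_pt] at hv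
  obtain ⟨i, rfl⟩ := hv
  obtain ⟨j, x, h1, h2, h3, rfl, rfl⟩ := h.exists_rep_next hD hf
  obtain ⟨j', x', h1', h2', h3', rfl, e⟩ := h.exists_rep_next hD hf'
  obtain rfl := eq_of_pt_eq e (by omega) (by omega)
  clear e
  wlog hlt : j < j' generalizing j j'
  · rcases (not_lt.1 hlt).eq_or_lt with e | hlt'
    · rw [e]
    · exact (this j' h1' j (by assumption) (by assumption) (by assumption) (by assumption)
        (by assumption) hlt').symm
  obtain ⟨a1, -, -, a2⟩ := (h.next_iff hD h1 h2 h3).1 hf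
  obtain ⟨b1, -⟩ := (h.next_iff hD h1' h2' h3).1 hf'
  have := ((h.bounds hD h1 (by omega)).1 a1).1
  rcases (h.arrow_out_mem_iff h1' (by omega)).1 b1 with e | e
  · omega
  · exact absurd ((h.arrow_in_mem_iff h1' (by omega)).2 (.inr e)) (a2 j' hlt h2')

lemma exists_next (h : W.Unrolls P) (hD : D ⊆ W.diagonals) {i x : ℤ} (h1 : i < x)
    (h2 : x < i + W.n) (hx : W.arrow (x, i) ∈ P.subdividedEdges D) :
    ∃ f, P.Next D (W.arrow (x, i)) f := by
  have hb := (h.bounds hD h1 h2).2 hx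
  have hi := W.lt_next i
  obtain ⟨j, ⟨hj1, hj2, hj3⟩, hmax⟩ := Int.exists_greatest_of_bdd
    (P := fun j ↦ i < j ∧ j < x ∧ W.arrow (i, j) ∈ P.subdividedEdges D)
    ⟨x, fun z hz ↦ hz.2.1.le⟩
    ⟨W.next i, hi, hb.1, (h.arrow_out_mem_iff hi (by omega)).2 (.inl rfl)⟩
  refine ⟨_, (h.next_iff hD hj1 hj2 h2).2 ⟨hj3, hj2, hx, fun y h3 h4 hy ↦ ?_⟩⟩
  simp only at h3
  rcases (h.arrow_in_mem_iff (by omega) (by omega)).1 hy with e | e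
  · simp only at e
    omega
  · have := hmax y ⟨by omega, h4, (h.arrow_out_mem_iff (by omega) (by omega)).2 (.inr e)⟩
    omega

/-- A line that is rotated from a segment of the subdivided polygon arrives at the previous
segment. -/
lemma exists_iterate_of_next (h : W.Unrolls P) (hD : D ⊆ W.diagonals) {u : ℂ} {i j : ℤ}
    (h1 : i < j) (h2 : j < i + W.n) (hN : P.Next D (u, W.pt i) (W.pt i, W.pt j)) :
    ∃ x N, j < x ∧ x < i + W.n ∧ W.pt x = u ∧ (W.step D)^[N] (i, j) = (x, i) := by
  obtain ⟨j', x, h1', h3, h4, e, rfl⟩ := h.exists_rep_next hD hN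
  obtain rfl := eq_of_pt_eq e (by omega) (by omega)
  obtain ⟨hj, hx⟩ := (h.next_iff hD h1 h3 h4).1 hN
  have hP : W.Pivot (i, j') := .inl ((h.bounds hD h1 h2).1 hj)
  obtain ⟨x', hx', -, -, N, hN⟩ := h.exists_firstHit hD hP
  obtain rfl := hx.unique hx'
  exact ⟨x, N, h3, h4, rfl, hN⟩

lemma exists_rep_arrow (h : W.Unrolls P) (hD : D ⊆ W.diagonals) {e : ℂ × ℂ}
    (he : e ∈ P.subdividedEdges D) :
    ∃ i j : ℤ, i < j ∧ j < i + W.n ∧ e = W.arrow (i, j) := by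
  rcases he with he | he
  · rw [h.E_eq] at he
    obtain ⟨i, rfl⟩ := he
    have := W.next_lt i
    have := prev_lt (W := W) i
    exact ⟨i, W.next i, W.lt_next i, by omega, rfl⟩
  · obtain ⟨⟨a, b⟩, hp, -, hab⟩ := hD he
    have hw := hp.window
    simp only at hw
    have e1 := W.pt_add a
    have e2 := W.pt_add b
    obtain ⟨e1', e2'⟩ := e
    rcases Sym2.eq_iff.1 hab with ⟨h1, h2⟩ | ⟨h1, h2⟩ <;> simp only at h1 h2 <;> subst h1 h2 <;>
      rcases hw with hw | hw
    · exact ⟨a, b, by omega, by omega, rfl⟩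
    · exact ⟨a, b + W.n, by omega, by omega, by simp [arrow, e2]⟩
    · exact ⟨b, a + W.n, by omega, by omega, by simp [arrow, e1]⟩
    · exact ⟨b, a, by omega, by omega, rfl⟩

end Unrolls

end Unrolling

namespace Unrolling.Unrolls

variable {W : Unrolling ℂ} {P : CyclicPolygon} {D : Set (Sym2 ℂ)}

lemma mem_of_mem_cycleFrom {e f : ℂ × ℂ} (he : e ∈ P.subdividedEdges D)
    (hf : f ∈ P.cycleFrom D e) : f ∈ P.subdividedEdges D := by
  rcases Relation.ReflTransGen.cases_tail hf with rfl | ⟨g, -, hg⟩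
  · exact he
  · exact hg.2.1

/-- It suffices to check that the lines starting at segments of the subdivided polygon close up. -/
lemma closed_of_arrow (h : W.Unrolls P) (hD : D ⊆ W.diagonals)
    (hc : ∀ i j : ℤ, i < j → j < i + W.n → W.arrow (i, j) ∈ P.subdividedEdges D →
      (W.step D)^[W.n] (i, j) = W.flip (i, j)) : W.Closed D := by
  intro s hs
  obtain ⟨x, hx, hP, -, N, hN⟩ := h.exists_firstHit hD hs
  have key : (W.step D)^[W.n] (x, s.1) = W.flip (x, s.1) := by
    have hw := hP.window
    simp only at hw
    rcases hw with hw | hw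
    · exact hc _ _ hw.1 (by omega) hx.2.1
    · have hP' : W.Pivot (x - W.n, s.1) :=
        hP.congr (by simp) (by simp) (by simp only; omega) (by simp only; omega)
      have hlt : x - W.n < s.1 := by omega
      have e : W.flip (x - W.n, s.1) = (x, s.1) := by
        rw [flip, if_pos hlt]; simp
      rw [← e, iterate_step_flip hD hP', hc _ _ hlt (by omega)
        (by simpa [arrow, W.pt_sub] using hx.2.1)]
  rw [← hN, ← Function.iterate_add_apply, add_comm, Function.iterate_add_apply,
    ← iterate_step_flip hD hs] at key
  exact iterate_step_injOn hD (hs.iterate hD _) hs.flip key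

/-- While a line is rotated from one edge of a star all the way to itself, it visits every vertex of
the star once as a pivot, and thus makes one half-turn. -/
lemma closed_of_isStarDecomposition (h : W.Unrolls P) (hS : P.IsStarDecomposition D) :
    W.Closed D := by
  have hD : D ⊆ W.diagonals := fun d hd ↦ (h.isDiagonal_iff d).1 (hS.1 d hd)
  refine h.closed_of_arrow hD fun i₀ j₀ hij hji he ↦ ?_
  obtain ⟨S, ⟨k, hk, hcard, hlen⟩, hE⟩ := hS.2 _ he
  have heS : W.arrow (i₀, j₀) ∈ S.E := by rw [hE]; exact .refl
  obtain ⟨U, hU⟩ := S.exists_unrolls ⟨_, S.fst_mem _ heS⟩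
  have hm : U.n = 2 * k + 1 := by rw [← hU.ncard_V, hcard]
  have hnext : ∀ l, U.next l = l + k := by
    intro l
    have := hU.edgeLength l
    rw [hlen _ (hU.edge l)] at this
    omega
  have hedge : ∀ l, (U.pt l, U.pt (l + k)) ∈ S.E := fun l ↦ hnext l ▸ hU.edge l
  have hsub : ∀ e ∈ S.E, e ∈ P.subdividedEdges D := fun e he' ↦
    mem_of_mem_cycleFrom he (hE ▸ he')
  -- Consecutive edges of the star follow each other in the subdivided polygon.
  have hNext : ∀ l, P.Next D (U.pt l, U.pt (l + k)) (U.pt (l + k), U.pt (l + k + k)) := by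
    intro l
    obtain ⟨i, j, h1, h2, e⟩ := h.exists_rep_arrow hD (hsub _ (hedge l))
    have e' : (U.pt l, U.pt (l + k)) = W.arrow (i + W.n, j) := by
      rw [e]; simp [arrow, W.pt_add]
    obtain ⟨⟨v, w⟩, hf⟩ := h.exists_next hD h2 (by omega) (e' ▸ hsub _ (hedge l))
    rw [← e'] at hf
    obtain rfl : v = U.pt (l + k) := hf.2.2.1
    have hmem : (U.pt (l + k), w) ∈ S.E := by
      have := hedge l
      rw [hE] at this ⊢
      exact Relation.ReflTransGen.tail this hf
    rwa [(S.existsUnique_out _ (hU.mem_V _)).unique hmem (hedge (l + k))] at hf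
  obtain ⟨l, hl, hl'⟩ : ∃ l, W.pt i₀ = U.pt l ∧ W.pt j₀ = U.pt (l + k) := by
    rw [hU.E_eq] at heS
    obtain ⟨l, hl⟩ := heS
    beta_reduce at hl
    rw [hnext] at hl
    exact ⟨l, (Prod.mk.inj hl).1.symm, (Prod.mk.inj hl).2.symm⟩
  have hper : ∀ l, U.pt (l - k - k) = U.pt (l + 1) := by
    intro l
    rw [← U.pt_add, hm]
    congr 1
    push_cast
    ring
  -- Two steps along the star lead from an edge to the edge whose starting point comes next.
  have key : ∀ d : ℕ, d ≤ 2 * k → ∃ (N : ℕ) (i j : ℤ), (W.step D)^[N] (i₀, j₀) = (i, j) ∧ i < j ∧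
      j < i + W.n ∧ W.pt i = U.pt (l + d) ∧ W.pt j = U.pt (l + d + k) ∧
      ((d = 0 ∧ i = i₀) ∨ (i₀ < i ∧ i < i₀ + W.n)) := by
    intro d
    induction d with
    | zero =>
      intro _
      exact ⟨0, i₀, j₀, rfl, hij, hji, by simpa using hl, by simpa using hl', .inl ⟨rfl, rfl⟩⟩
    | succ d ih =>
      intro hd
      obtain ⟨N, i, j, hN, h1, h2, h3, h4, h5⟩ := ih (by omega)
      have n1 := hNext (l + d - k)
      have n2 := hNext (l + d - k - k)
      rw [sub_add_cancel, ← h3, ← h4] at n1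
      rw [sub_add_cancel, sub_add_cancel, ← h3] at n2
      obtain ⟨x, N₁, a1, a2, a3, a4⟩ := h.exists_iterate_of_next hD h1 h2 n1
      rw [← a3, ← W.pt_sub x] at n2
      obtain ⟨y, N₂, b1, b2, b3, b4⟩ := h.exists_iterate_of_next hD (by omega) (by omega) n2
      rw [hper] at b3
      have hP : W.Pivot (x - W.n, i) := by
        refine .inl ((h.bounds hD (by omega) (by omega)).1 n2.2.1)
      have e1 : W.flip (x - W.n, i) = (x, i) := by
        rw [flip, if_pos (by simp only; omega)]; simp
      have e2 : W.flip (y, x - W.n) = (y, x) := by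
        rw [flip, if_neg (by simp only; omega)]; simp
      refine ⟨N₂ + (N₁ + N), y, x, ?_, by omega, by omega, ?_, ?_, .inr ?_⟩
      · rw [Function.iterate_add_apply, Function.iterate_add_apply, hN, a4, ← e1,
          iterate_step_flip hD hP, b4, e2]
      · rw [b3]; push_cast; ring_nf
      · rw [a3, ← U.pt_add, hm]; push_cast; ring_nf
      · rcases h5 with ⟨-, rfl⟩ | ⟨h5, h6⟩
        · omega
        · have hac := hU.anticlockwise l (l + d) (l + d + 1)
            (by
              by_contra hlt
              have : d = 0 := by omega
              subst this
              have := eq_of_pt_eq (W := W) (i := i) (j := i₀) (by rw [h3, hl]; simp)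
                (by omega) (by omega)
              omega)
            (by omega) (by omega)
          rw [← hl, ← h3, ← b3] at hac
          refine ⟨by omega, ?_⟩
          by_contra hle
          rcases (not_lt.1 hle).eq_or_lt with e | hlt
          · exact hac.ne₁₃ (by rw [← e, W.pt_add])
          · rw [← W.pt_sub y] at hac
            have := (h.anticlockwise_iff h5 h6 (by omega) (by omega)).1 hac
            omega
  obtain ⟨N, i, j, hN, h1, h2, h3, h4, h5⟩ := key k (by omega)
  have hij₀ : j₀ = i := eq_of_pt_eq (by rw [h3, hl']) (by omega) (by omega)
  subst hij₀
  have n1 := hNext l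
  rw [← hl, ← hl', ← h4] at n1
  obtain ⟨x, N₁, a1, a2, a3, a4⟩ := h.exists_iterate_of_next hD h1 h2 n1
  have hx : x = i₀ + W.n := eq_of_pt_eq (by rw [a3, W.pt_add]) (by omega) (by omega)
  have hfin : (W.step D)^[N₁ + N] (i₀, j₀) = (i₀ + W.n, j₀) := by
    rw [Function.iterate_add_apply, hN, a4, hx]
  have hsum := iterate_step_sum (W := W) D (i₀, j₀) (N₁ + N)
  rw [hfin] at hsum
  have hNn : N₁ + N = W.n := by simp only at hsum; omega
  rw [← hNn, hfin, flip, if_pos hij]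

/-- If all lines close up after a half-turn, then all cycles are stars: the pivots of a line are
visited in anti-clockwise order if every second one is skipped, and the number of all pivots is
odd since a half-turn exchanges the two ends of the line. -/
lemma isStarDecomposition_of_closed (h : W.Unrolls P) (hD : D ⊆ W.diagonals) (hc : W.Closed D) :
    P.IsStarDecomposition D := by
  refine ⟨fun d hd ↦ (h.isDiagonal_iff d).2 (hD hd), fun e he ↦ ?_⟩
  have hn := n_pos (W := W)
  obtain ⟨i₀, j₀, hij, hji, rfl⟩ := h.exists_rep_arrow hD he
  have hP₀ : W.Pivot (i₀, j₀) := .inl ((h.bounds hD hij hji).1 he)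
  choose! g hg using fun s (hs : W.Pivot s) ↦ h.exists_firstHit hD hs
  -- The map `R` takes a segment of the subdivided polygon to the previous one.
  set R : ℤ × ℤ → ℤ × ℤ := fun s ↦ (g s, s.1)
  have hRP : ∀ s, W.Pivot s → W.Pivot (R s) := fun s hs ↦ (hg s hs).2.1
  have hRmem : ∀ s, W.Pivot s → W.arrow (R s) ∈ P.subdividedEdges D := fun s hs ↦ (hg s hs).1.2.1
  have hRlt : ∀ s, W.Pivot s → (s.1 < s.2 ↔ ¬ (R s).1 < (R s).2) := by
    intro s hs
    have hw := (hg s hs).2.1.window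
    rw [(hg s hs).2.2.1]
    simp only [R] at hw ⊢
    omega
  have hRflip : ∀ s, W.Pivot s → R (W.flip s) = W.flip (R s) := by
    intro s hs
    have hw := (hg s hs).2.1.window
    have hw' := hs.window
    have hlt := (hg s hs).2.2.1
    have h1 := (hg s hs).1.flip hs hlt (by simp only at hw; omega)
    have h2 := h1.unique (hg _ hs.flip).1
    refine Prod.ext h2.symm ?_
    simp only [R, flip] at hw ⊢
    split_ifs <;> simp only at hw ⊢ <;> omega
  have hRnext : ∀ s, W.Pivot s → W.arrow s ∈ P.subdividedEdges D →
      P.Next D (W.arrow (R s)) (W.arrow s) := by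
    intro s hs hmem
    wlog hlt : s.1 < s.2 generalizing s
    · have hw := hs.window
      have := this (W.flip s) hs.flip (by simpa using hmem)
        (by rw [flip, if_neg hlt]; simp only; omega)
      rwa [hRflip s hs, arrow_flip, arrow_flip] at this
    · have hw := (hg s hs).2.1.window
      have hw' := hs.window
      have := (hg s hs).2.2.1
      have h1 := (hg s hs).1.1
      simp only at hw
      exact (h.next_iff hD hlt h1 (by omega)).2 ⟨hmem, (hg s hs).1⟩
  have hPit : ∀ r, W.Pivot (R^[r] (i₀, j₀)) := by
    intro r
    induction r with
    | zero => exact hP₀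
    | succ r ih => rw [Function.iterate_succ_apply']; exact hRP _ ih
  have hmemit : ∀ r, W.arrow (R^[r] (i₀, j₀)) ∈ P.subdividedEdges D := by
    intro r
    cases r with
    | zero => exact he
    | succ r => rw [Function.iterate_succ_apply']; exact hRmem _ (hPit r)
  have hnextit : ∀ r, P.Next D (W.arrow (R^[r + 1] (i₀, j₀))) (W.arrow (R^[r] (i₀, j₀))) := by
    intro r
    rw [Function.iterate_succ_apply']
    exact hRnext _ (hPit r) (hmemit r)
  have hreach : ∀ N s, W.Pivot s → W.arrow ((W.step D)^[N] s) ∈ P.subdividedEdges D →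
      ∃ r, R^[r] s = (W.step D)^[N] s := by
    intro N
    induction N using Nat.strong_induction_on with
    | _ N ih =>
    intro s hs hmem
    rcases Nat.eq_zero_or_pos N with rfl | hN
    · exact ⟨0, rfl⟩
    · obtain ⟨x, N', h1, h2, h3⟩ := h.exists_firstHit_of_mem hs hN hmem
      obtain rfl := h1.unique (hg s hs).1
      obtain ⟨r, hr⟩ := ih N' h2 (R s) (hRP s hs) (by rw [h3]; exact hmem)
      exact ⟨r + 1, by rw [Function.iterate_succ_apply, hr, h3]⟩
  obtain ⟨m, hm⟩ : ∃ m, R^[m] (i₀, j₀) = W.flip (i₀, j₀) := by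
    rw [← hc _ hP₀]
    refine hreach _ _ hP₀ ?_
    rw [hc _ hP₀, arrow_flip]
    exact he
  have hmr : ∀ r, R^[r + m] (i₀, j₀) = W.flip (R^[r] (i₀, j₀)) := by
    intro r
    induction r with
    | zero => rw [zero_add, hm]; rfl
    | succ r ih =>
      rw [add_right_comm, Function.iterate_succ_apply', ih, hRflip _ (hPit r),
        Function.iterate_succ_apply']
  have hpar : ∀ r, (R^[r] (i₀, j₀)).1 < (R^[r] (i₀, j₀)).2 ↔ Even r := by
    intro r
    induction r with
    | zero => simpa using hij
    | succ r ih =>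
      rw [Nat.even_add_one, ← ih, hRlt _ (hPit r), Function.iterate_succ_apply', not_not]
  obtain ⟨k, hk⟩ : Odd m := by
    rw [← Nat.not_even_iff_odd, ← hpar, hm, flip, if_pos hij]
    simp only
    omega
  have hk0 : 0 < k := by
    by_contra hk0
    obtain rfl : m = 1 := by omega
    have := congrArg Prod.snd hm
    simp only [Function.iterate_one, R, flip, if_pos hij] at this
    omega
  set s : ℕ → ℤ := fun d ↦ (R^[2 * d] (i₀, j₀)).1 with hs
  have hs2 : ∀ d, R^[2 * d] (i₀, j₀) = (s d, s (d + k)) := by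
    intro d
    refine Prod.ext rfl ?_
    have h1 := hmr (2 * d)
    rw [show 2 * d + m = 2 * (d + k) + 1 by omega, Function.iterate_succ_apply', flip,
      if_pos ((hpar _).2 (by simp))] at h1
    exact (congrArg Prod.snd h1).symm
  have hsm : ∀ d, s (d + m) = s d + W.n := by
    intro d
    have hlt := (hpar (2 * d)).2 (by simp)
    have hw := (hPit (2 * d)).window
    simp only [hs]
    rw [show 2 * (d + m) = 2 * d + m + m by ring, hmr, hmr, flip, flip, if_pos hlt,
      if_neg (by simp only; omega)]
  have hslt : ∀ d, s d < s (d + 1) := by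
    intro d
    simp only [hs, show 2 * (d + 1) = 2 * d + 1 + 1 by ring]
    rw [Function.iterate_succ_apply' R (2 * d + 1)]
    have := (hg _ (hPit (2 * d + 1))).1.1
    rwa [Function.iterate_succ_apply' R (2 * d)] at this ⊢
  obtain ⟨G, hG, hGm, hGs⟩ := exists_periodic_extension (R := ℤ) (m := m) (by omega) (g := s)
    (c := W.n) (fun i _ ↦ hslt i)
    (by
      have := hslt (m - 1)
      rw [Nat.sub_add_cancel (by omega)] at this
      have h0 := hsm 0
      rw [zero_add] at h0
      omega)
  have hGs' : ∀ d : ℕ, G d = s d := by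
    intro d
    induction d using Nat.strong_induction_on with
    | _ d ih =>
    rcases lt_or_ge d m with hlt | hle
    · exact hGs d hlt
    · obtain ⟨c, rfl⟩ := Nat.exists_eq_add_of_le' hle
      rw [hsm, ← ih c (by omega), ← hGm]
      simp
  have hGmul : ∀ i q : ℤ, G (i + q * m) = G i + q * W.n := by
    intro i q
    induction q using Int.induction_on with
    | zero => simp
    | succ q ih => rw [add_mul, one_mul, ← add_assoc, hGm, ih]; ring
    | pred q ih =>
      have := hGm (i + (-(q : ℤ) - 1) * m)
      rw [show i + (-(q : ℤ) - 1) * m + m = i + -(q : ℤ) * m by ring, ih] at this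
      linarith
  have hpt : ∀ i j, W.pt (G i) = W.pt (G j) ↔ (m : ℤ) ∣ j - i := by
    intro i j
    have h0 := Int.emod_nonneg (j - i) (b := m) (by omega)
    have h1 := Int.emod_lt_of_pos (j - i) (b := m) (by omega)
    have h2 := Int.emod_add_mul_ediv (j - i) m
    have h3 := hGmul (i + (j - i) % m) ((j - i) / m)
    rw [show i + (j - i) % m + (j - i) / m * m = j by linarith] at h3
    have h4 : W.pt (G j) = W.pt (G (i + (j - i) % m)) := by
      rw [W.pt_eq_iff, h3]
      exact ⟨-((j - i) / m), by ring⟩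
    rw [h4, Int.dvd_iff_emod_eq_zero]
    constructor
    · intro he
      have a1 : G i ≤ G (i + (j - i) % m) := hG.monotone (by omega)
      have a2 : G (i + (j - i) % m) < G (i + m) := hG (by omega)
      rw [hGm] at a2
      have := hG.injective (eq_of_pt_eq he (by omega) a2)
      omega
    · intro he
      rw [he, add_zero]
  let U : Unrolling ℂ :=
    { n := m
      pt := fun i ↦ W.pt (G i)
      pt_eq_iff := hpt
      next := fun i ↦ i + k
      prev := fun i ↦ i - k
      next_prev := fun i ↦ by ring
      prev_next := fun i ↦ by ring
      next_add := fun i ↦ by ring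
      prev_add := fun i ↦ by ring
      lt_next := fun i ↦ by omega
      next_lt := fun i ↦ by omega }
  have hUac : ∀ i j k : ℤ, i < j → j < k → k < i + U.n →
      Anticlockwise (U.pt i) (U.pt j) (U.pt k) := by
    intro i j k h1 h2 h3
    exact h.anticlockwise _ _ _ (hG h1) (hG h2) (by rw [← hGm]; exact hG h3)
  have hUcirc : ∃ (c : ℂ) (r : ℝ), 0 < r ∧ ∀ v ∈ Set.range U.pt, dist v c = r := by
    obtain ⟨c, r, hr, hV⟩ := P.concyclic
    refine ⟨c, r, hr, ?_⟩
    rintro _ ⟨i, rfl⟩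
    exact hV _ (h.mem_V _)
  have hU := U.unrolls_toCyclicPolygon hUac hUcirc
  have harrow : ∀ r, W.arrow (R^[r + m] (i₀, j₀)) = W.arrow (R^[r] (i₀, j₀)) := fun r ↦ by
    rw [hmr, arrow_flip]
  have harrow' : ∀ r c, W.arrow (R^[r + c * m] (i₀, j₀)) = W.arrow (R^[r] (i₀, j₀)) := by
    intro r c
    induction c with
    | zero => simp
    | succ c ih => rw [add_mul, one_mul, ← add_assoc, harrow, ih]
  have heven : ∀ d : ℕ, W.arrow (R^[2 * d] (i₀, j₀)) = (U.pt d, U.pt (U.next d)) := by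
    intro d
    rw [hs2, ← hGs', ← hGs']
    simp [U, arrow]
  refine ⟨U.toCyclicPolygon hUac hUcirc, ⟨k, hk0, ?_, fun e heE ↦ ?_⟩, Set.Subset.antisymm ?_ ?_⟩
  · rw [hU.ncard_V]; exact hk
  · rw [hU.E_eq] at heE
    obtain ⟨i, rfl⟩ := heE
    have := hU.edgeLength i
    simp only [U, add_sub_cancel_left] at this ⊢
    exact_mod_cast this
  · rw [hU.E_eq]
    rintro _ ⟨i, rfl⟩
    beta_reduce
    -- Every edge of the star occurs among the segments visited by `R`.
    obtain ⟨d, hd⟩ : ∃ d : ℕ, W.arrow (R^[2 * d] (i₀, j₀)) = (U.pt i, U.pt (U.next i)) := by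
      refine ⟨(i % m).toNat, ?_⟩
      have h0 := Int.emod_nonneg i (b := m) (by omega)
      have h2 := Int.emod_add_mul_ediv i m
      rw [heven, Int.toNat_of_nonneg h0]
      refine Prod.ext ((U.pt_eq_iff _ _).2 ⟨i / m, ?_⟩) ((U.pt_eq_iff _ _).2 ⟨i / m, ?_⟩) <;>
        simp only [U] <;> linarith
    rw [← hd]
    have hchain : ∀ r a, Relation.ReflTransGen (P.Next D) (W.arrow (R^[r + a] (i₀, j₀)))
        (W.arrow (R^[r] (i₀, j₀))) := by
      intro r a
      induction a with
      | zero => exact .refl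
      | succ a ih => exact .head (hnextit (r + a)) ih
    have h1 := hchain (2 * d) (2 * d * (m - 1))
    have h2 : 2 * d + 2 * d * (m - 1) = 0 + 2 * d * m := by
      obtain ⟨m', rfl⟩ : ∃ m', m = m' + 1 := ⟨m - 1, by omega⟩
      simp; ring
    rw [h2, harrow'] at h1
    exact h1
  · intro f hf
    have hvisit : ∃ r, f = W.arrow (R^[r] (i₀, j₀)) := by
      induction hf with
      | refl => exact ⟨0, rfl⟩
      | tail _ hN ih =>
        obtain ⟨r, rfl⟩ := ih
        refine ⟨r + (m - 1), h.next_unique hD hN ?_⟩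
        rw [← harrow r, show r + m = r + (m - 1) + 1 by omega]
        exact hnextit _
    obtain ⟨r, rfl⟩ := hvisit
    obtain ⟨d, hd⟩ : ∃ d, W.arrow (R^[r] (i₀, j₀)) = W.arrow (R^[2 * d] (i₀, j₀)) := by
      rcases Nat.even_or_odd' r with ⟨c, rfl | rfl⟩
      · exact ⟨c, rfl⟩
      · refine ⟨c + k + 1, ?_⟩
        rw [← harrow, show 2 * c + 1 + m = 2 * (c + k + 1) by omega]
    rw [hd, heven]
    exact hU.edge d

lemma isStarDecomposition_iff (h : W.Unrolls P) :
    P.IsStarDecomposition D ↔ D ⊆ W.diagonals ∧ W.Closed D :=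
  ⟨fun hS ↦ ⟨fun d hd ↦ (h.isDiagonal_iff d).1 (hS.1 d hd), h.closed_of_isStarDecomposition hS⟩,
    fun hc ↦ h.isStarDecomposition_of_closed hc.1 hc.2⟩

end Unrolling.Unrolls

theorem mainTheorem1 (P : CyclicPolygon) (D₁ D₂ : Set (Sym2 ℂ))
    (h₁ : P.IsMaximalStarDecomposition D₁) (h₂ : P.IsMaximalStarDecomposition D₂) :
    Relation.ReflTransGen P.IsFlip D₁ D₂ := by
  rcases P.V.eq_empty_or_nonempty with hV | hV
  · have hempty : ∀ D, P.IsStarDecomposition D → D = ∅ := by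
      intro D hD
      refine Set.eq_empty_of_forall_notMem fun d hd ↦ ?_
      obtain ⟨u, v, ⟨hu, -⟩, -⟩ := hD.1 d hd
      simp [hV] at hu
    rw [hempty _ h₁.1, hempty _ h₂.1]
  · obtain ⟨W, hW⟩ := P.exists_unrolls hV
    have key : ∀ D, P.IsMaximalStarDecomposition D → D ⊆ W.diagonals ∧ W.Closed D ∧ W.Tight D := by
      intro D hD
      obtain ⟨hsub, hc⟩ := hW.isStarDecomposition_iff.1 hD.1
      exact ⟨hsub, hc, hc.tight_of_maximal hsub fun D' hss hsub' hc' ↦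
        hD.2 D' hss (hW.isStarDecomposition_iff.2 ⟨hsub', hc'⟩)⟩
    obtain ⟨s₁, c₁, t₁⟩ := key D₁ h₁
    obtain ⟨s₂, c₂, t₂⟩ := key D₂ h₂
    refine Relation.ReflTransGen.mono ?_ _ _ (Unrolling.exchange_connected s₁ c₁ t₁ s₂ c₂ t₂)
    rintro D D' ⟨hs, hs', hc, hc', e, he, f, hf, rfl⟩
    exact ⟨hW.isStarDecomposition_iff.2 ⟨hs, hc⟩, hW.isStarDecomposition_iff.2 ⟨hs', hc'⟩,
      e, he, f, hf, by rw [Set.union_singleton]⟩
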